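/- Let $G$ be a finite metric tree with at least one edge: a finite, connected graph without cycles, with vertex set $V$ and nonempty edge set $E$, in which each edge $e$ has a length $L(e)\in(0,\infty)$ and is identified with the interval $[0,L(e)]$. In $L^2(G)=\bigoplus_{e\in E}L^2(0,L(e))$ (complex-valued functions) consider two operators, both acting as $f\mapsto(-f_e'')_{e\in E}$. The standard Laplacian $-\Delta_G$ has as domain all $f\in\bigoplus_{e\in E}H^2(0,L(e))$ that are continuous on $G$ and satisfy, at each vertex $v$, $\sum_{e\text{ ends at }v}f_e'(L(e))-\sum_{e\text{ starts at }v}f_e'(0)=0$. The Dirichlet Laplacian $-\Delta_G^{\mathrm D}$ has as domain all $f\in\bigoplus_{e\in E}H^2(0,L(e))$ that are continuous on $G$ and vanish at every vertex. Then the eigenvalues of each of the two operators, counted with their (finite) multiplicities, can be enumerated as a nondecreasing sequence of real numbers, $\lambda_1(G)\le\lambda_2(G)\le\cdots$ for $-\Delta_G$ and $\lambda_1^{\mathrm D}(G)\le\lambda_2^{\mathrm D}(G)\le\cdots$ for $-\Delta_G^{\mathrm D}$, and $$\lambda_{k+1}(G)\le\lambda_k^{\mathrm D}(G)\qquad\text{for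 all }k\in\{1,2,\dots\}.$$ Moreover, the inequality is strict for all $k\in\{1,2,\dots\}$ if and only if $G$ contains two edges whose lengths are linearly independent over $\mathbb{Q}$. -/

import Mathlib

open MeasureTheory Set

noncomputable section

/-- A (directed, weighted) multigraph with vertices `V` and edges `E`: the edge `e` runs from the
vertex `o e` to the vertex `t e` and is identified with the interval `[0, len e]`. -/
structure MetricGraph (V E : Type*) where
  o : E → V
  t : E → V
  len : E → ℝ
  len_pos : ∀ e, 0 < len e

namespace MetricGraph

variable {V E : Type*}

/-- Two distinct vertices are adjacent if some edge joins them, in either direction. -/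
def adjacency (G : MetricGraph V E) : SimpleGraph V :=
  SimpleGraph.fromEdgeSet (Set.range fun e => s(G.o e, G.t e))

/-- `G` is connected and contains no cycles. A loop is a cycle of length one and a pair of parallel
edges is a cycle of length two, so both are excluded. -/
structure IsTree (G : MetricGraph V E) : Prop where
  no_loop : ∀ e, G.o e ≠ G.t e
  no_parallel : ∀ e e', s(G.o e, G.t e) = s(G.o e', G.t e') → e = e'
  adjacency_isTree : G.adjacency.IsTree

/-- The Hilbert space `L²(G) = ⨁ₑ L²(0, len e)` of complex-valued functions. -/
abbrev L2 [Fintype E] (G : MetricGraph V E) : Type _ :=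
  PiLp 2 fun e => Lp ℂ 2 (volume.restrict (Icc 0 (G.len e)))

end MetricGraph

/-- On `[0, ℓ]`, the function `f` is the continuous representative of an element of the Sobolev space
`H²(0, ℓ)`, with first derivative `f₁` (absolutely continuous) and second derivative
`f₂ ∈ L²(0, ℓ)`. -/
structure IsSobolevTwo (ℓ : ℝ) (f f₁ f₂ : ℝ → ℂ) : Prop where
  memLp : MemLp f₂ 2 (volume.restrict (Icc 0 ℓ))
  eq_integral : ∀ x ∈ Icc 0 ℓ, f x = f 0 + ∫ s in 0..x, f₁ s
  deriv_eq_integral : ∀ x ∈ Icc 0 ℓ, f₁ x = f₁ 0 + ∫ s in 0..x, f₂ s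

namespace IsSobolevTwo

variable {ℓ : ℝ} {f f₁ f₂ g g₁ g₂ : ℝ → ℂ}

theorem intervalIntegrable_two (hf : IsSobolevTwo ℓ f f₁ f₂) {x : ℝ} (hx : x ∈ Icc 0 ℓ) :
    IntervalIntegrable f₂ volume 0 x := by
  have h : IntegrableOn f₂ (Icc 0 ℓ) := hf.memLp.integrable (by norm_num)
  rw [intervalIntegrable_iff_integrableOn_Icc_of_le hx.1]
  exact h.mono_set (Icc_subset_Icc_right hx.2)

theorem continuousOn_one (hf : IsSobolevTwo ℓ f f₁ f₂) : ContinuousOn f₁ (Icc 0 ℓ) := by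
  have h : IntegrableOn f₂ (Icc 0 ℓ) := hf.memLp.integrable (by norm_num)
  have hc : ContinuousOn (fun x => f₁ 0 + ∫ s in Icc 0 x, f₂ s) (Icc 0 ℓ) :=
    continuousOn_const.add (intervalIntegral.continuousOn_primitive_Icc h)
  refine hc.congr fun x hx => ?_
  beta_reduce
  rw [hf.deriv_eq_integral x hx, intervalIntegral.integral_of_le hx.1,
    integral_Icc_eq_integral_Ioc]

theorem intervalIntegrable_one (hf : IsSobolevTwo ℓ f f₁ f₂) {x : ℝ} (hx : x ∈ Icc 0 ℓ) :
    IntervalIntegrable f₁ volume 0 x :=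
  (hf.continuousOn_one.mono (by rw [uIcc_of_le hx.1]; exact Icc_subset_Icc_right hx.2))
    |>.intervalIntegrable

theorem continuousOn (hf : IsSobolevTwo ℓ f f₁ f₂) : ContinuousOn f (Icc 0 ℓ) := by
  have h : IntegrableOn f₁ (Icc 0 ℓ) := hf.continuousOn_one.integrableOn_Icc
  have hc : ContinuousOn (fun x => f 0 + ∫ s in Icc 0 x, f₁ s) (Icc 0 ℓ) :=
    continuousOn_const.add (intervalIntegral.continuousOn_primitive_Icc h)
  refine hc.congr fun x hx => ?_
  beta_reduce
  rw [hf.eq_integral x hx, intervalIntegral.integral_of_le hx.1,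
    integral_Icc_eq_integral_Ioc]

theorem zero (ℓ : ℝ) : IsSobolevTwo ℓ 0 0 0 :=
  ⟨MemLp.zero, by simp, by simp⟩

theorem add (hf : IsSobolevTwo ℓ f f₁ f₂) (hg : IsSobolevTwo ℓ g g₁ g₂) :
    IsSobolevTwo ℓ (f + g) (f₁ + g₁) (f₂ + g₂) where
  memLp := hf.memLp.add hg.memLp
  eq_integral x hx := by
    simp only [Pi.add_apply]
    rw [intervalIntegral.integral_add (hf.intervalIntegrable_one hx) (hg.intervalIntegrable_one hx),
      hf.eq_integral x hx, hg.eq_integral x hx]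
    ring
  deriv_eq_integral x hx := by
    simp only [Pi.add_apply]
    rw [intervalIntegral.integral_add (hf.intervalIntegrable_two hx) (hg.intervalIntegrable_two hx),
      hf.deriv_eq_integral x hx, hg.deriv_eq_integral x hx]
    ring

theorem smul (c : ℂ) (hf : IsSobolevTwo ℓ f f₁ f₂) :
    IsSobolevTwo ℓ (c • f) (c • f₁) (c • f₂) where
  memLp := hf.memLp.const_smul c
  eq_integral x hx := by
    simp only [Pi.smul_apply, smul_eq_mul]
    rw [intervalIntegral.integral_const_mul, hf.eq_integral x hx, mul_add]
  deriv_eq_integral x hx := by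
    simp only [Pi.smul_apply, smul_eq_mul]
    rw [intervalIntegral.integral_const_mul, hf.deriv_eq_integral x hx, mul_add]

/-- An integrable function with zero integral over each `[0, x]`, `x ≤ ℓ`, vanishes almost
everywhere on `[0, ℓ]`. -/
theorem ae_zero_of_integral (hℓ : 0 < ℓ) {h : ℝ → ℂ} (hi : IntervalIntegrable h volume 0 ℓ)
    (h0 : ∀ x ∈ Icc 0 ℓ, ∫ s in 0..x, h s = 0) : h =ᵐ[volume.restrict (Icc 0 ℓ)] 0 := by
  rw [← restrict_Ioo_eq_restrict_Icc, Filter.EventuallyEq, ae_restrict_iff' measurableSet_Ioo]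
  filter_upwards [hi.ae_hasDerivAt_integral] with x hx hx'
  have hu : uIcc 0 ℓ = Icc 0 ℓ := uIcc_of_le hℓ.le
  have h1 := hx (by rw [hu]; exact Ioo_subset_Icc_self hx') 0 (by rw [hu]; exact ⟨le_rfl, hℓ.le⟩)
  have h2 : HasDerivAt (fun y => ∫ s in 0..y, h s) 0 x :=
    (hasDerivAt_const x (0 : ℂ)).congr_of_eventuallyEq (by
      filter_upwards [Ioo_mem_nhds hx'.1 hx'.2] with y hy
      exact h0 y (Ioo_subset_Icc_self hy))
  exact h1.unique h2

/-- If `f` vanishes almost everywhere then so does its second derivative. -/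
theorem ae_zero (hℓ : 0 < ℓ) (hf : IsSobolevTwo ℓ f f₁ f₂)
    (h0 : f =ᵐ[volume.restrict (Icc 0 ℓ)] 0) : f₂ =ᵐ[volume.restrict (Icc 0 ℓ)] 0 := by
  have hend : ℓ ∈ Icc 0 ℓ := ⟨hℓ.le, le_rfl⟩
  have hstart : (0 : ℝ) ∈ Icc 0 ℓ := ⟨le_rfl, hℓ.le⟩
  have e0 : EqOn f 0 (Icc 0 ℓ) :=
    Measure.eqOn_Icc_of_ae_eq volume hℓ.ne h0 hf.continuousOn continuousOn_const
  have e1 : EqOn f₁ 0 (Icc 0 ℓ) := by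
    refine Measure.eqOn_Icc_of_ae_eq volume hℓ.ne ?_ hf.continuousOn_one continuousOn_const
    refine ae_zero_of_integral hℓ (hf.intervalIntegrable_one hend) fun x hx => ?_
    have := hf.eq_integral x hx
    rw [e0 hx, e0 hstart] at this
    simpa using this.symm
  refine ae_zero_of_integral hℓ (hf.intervalIntegrable_two hend) fun x hx => ?_
  have := hf.deriv_eq_integral x hx
  rw [e1 hx, e1 hstart] at this
  simpa using this.symm

end IsSobolevTwo

namespace MetricGraph

variable {V E : Type*}

/-- The edge functions `f e` take the value `c v` at each end of an edge incident to the vertex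
`v`. -/
def HasVertexValues (G : MetricGraph V E) (f : E → ℝ → ℂ) (c : V → ℂ) : Prop :=
  ∀ e, f e 0 = c (G.o e) ∧ f e (G.len e) = c (G.t e)

open Classical in
/-- The sum of the normal derivatives at the vertex `v` of a function with edgewise derivative
`f₁`. -/
def normalDeriv [Fintype E] (G : MetricGraph V E) (f₁ : E → ℝ → ℂ) (v : V) : ℂ :=
  ∑ e with G.t e = v, f₁ e (G.len e) - ∑ e with G.o e = v, f₁ e 0

/-- A vertex condition on the edgewise values and first derivatives which is linear. -/
structure IsLinearCondition (B : (E → ℝ → ℂ) → (E → ℝ → ℂ) → Prop) : Prop where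
  zero : B 0 0
  add : ∀ {f f₁ g g₁}, B f f₁ → B g g₁ → B (f + g) (f₁ + g₁)
  smul : ∀ (c : ℂ) {f f₁}, B f f₁ → B (c • f) (c • f₁)

/-- Standard (continuity and Kirchhoff) vertex conditions: `f` is continuous on `G` and the normal
derivatives sum up to zero at each vertex. -/
def StandardCondition [Fintype E] (G : MetricGraph V E) (f f₁ : E → ℝ → ℂ) : Prop :=
  (∃ c : V → ℂ, G.HasVertexValues f c) ∧ ∀ v, G.normalDeriv f₁ v = 0

/-- Dirichlet conditions: `f` vanishes at all vertices. -/
def DirichletCondition (G : MetricGraph V E) (f _f₁ : E → ℝ → ℂ) : Prop :=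
  G.HasVertexValues f 0

theorem isLinearCondition_standard [Fintype E] (G : MetricGraph V E) :
    IsLinearCondition G.StandardCondition where
  zero := ⟨⟨0, fun e => by simp⟩, fun v => by simp [normalDeriv]⟩
  add := by
    rintro f f₁ g g₁ ⟨⟨c, hc⟩, hf⟩ ⟨⟨d, hd⟩, hg⟩
    refine ⟨⟨c + d, fun e => by simp [hc e, hd e]⟩, fun v => ?_⟩
    have h := congrArg₂ (· + ·) (hf v) (hg v)
    simp only [normalDeriv, Pi.add_apply, Finset.sum_add_distrib, add_zero] at h ⊢
    rw [← h]; ring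
  smul := by
    rintro a f f₁ ⟨⟨c, hc⟩, hf⟩
    refine ⟨⟨a • c, fun e => by simp [hc e]⟩, fun v => ?_⟩
    have h := congrArg (a * ·) (hf v)
    simp only [normalDeriv, Pi.smul_apply, smul_eq_mul, ← Finset.mul_sum, mul_zero] at h ⊢
    rw [← h]; ring

theorem isLinearCondition_dirichlet (G : MetricGraph V E) :
    IsLinearCondition G.DirichletCondition where
  zero := fun e => by simp
  add := fun hf hg e => by simp [hf e, hg e]
  smul := fun a _ _ hf e => by simp [hf e]

/-- The graph of the operator `(f e)ₑ ↦ (-(f e)'')ₑ` in `L²(G)` on those `f` which are edgewise in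
`H²` and satisfy the linear vertex condition `B`: all pairs `(φ, ψ)` such that `φ` is such a
function `f` and `ψ` is `-f''`. -/
def laplacianGraph [Fintype E] (G : MetricGraph V E) (B : (E → ℝ → ℂ) → (E → ℝ → ℂ) → Prop)
    (hB : IsLinearCondition B) : Submodule ℂ (G.L2 × G.L2) where
  carrier := {p | ∃ f f₁ f₂ : E → ℝ → ℂ, (∀ e, IsSobolevTwo (G.len e) (f e) (f₁ e) (f₂ e)) ∧
    B f f₁ ∧ (∀ e, p.1 e =ᵐ[volume.restrict (Icc 0 (G.len e))] f e) ∧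
    ∀ e, p.2 e =ᵐ[volume.restrict (Icc 0 (G.len e))] -f₂ e}
  zero_mem' := ⟨0, 0, 0, fun e => .zero _, hB.zero, fun e => Lp.coeFn_zero _ _ _, fun e => by
    have h := Lp.coeFn_zero ℂ 2 (volume.restrict (Icc 0 (G.len e)))
    refine h.trans (Filter.EventuallyEq.of_eq ?_)
    simp⟩
  add_mem' := by
    rintro p q ⟨f, f₁, f₂, hf, hfB, hp1, hp2⟩ ⟨g, g₁, g₂, hg, hgB, hq1, hq2⟩
    refine ⟨f + g, f₁ + g₁, f₂ + g₂, fun e => (hf e).add (hg e), hB.add hfB hgB,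
      fun e => ?_, fun e => ?_⟩
    · exact (Lp.coeFn_add (p.1 e) (q.1 e)).trans ((hp1 e).add (hq1 e))
    · refine (Lp.coeFn_add (p.2 e) (q.2 e)).trans (((hp2 e).add (hq2 e)).trans ?_)
      exact Filter.EventuallyEq.of_eq (by simp only [Pi.add_apply, neg_add])
  smul_mem' := by
    rintro c p ⟨f, f₁, f₂, hf, hfB, hp1, hp2⟩
    refine ⟨c • f, c • f₁, c • f₂, fun e => (hf e).smul c, hB.smul c hfB,
      fun e => ?_, fun e => ?_⟩
    · exact (Lp.coeFn_smul c (p.1 e)).trans ((hp1 e).const_smul c)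
    · refine (Lp.coeFn_smul c (p.2 e)).trans (((hp2 e).const_smul c).trans ?_)
      exact Filter.EventuallyEq.of_eq (by simp only [Pi.smul_apply, smul_neg])

/-- The second derivative is uniquely determined, so that the graph is the graph of an operator. -/
theorem laplacianGraph_snd_eq_zero [Fintype E] (G : MetricGraph V E)
    (B : (E → ℝ → ℂ) → (E → ℝ → ℂ) → Prop) (hB : IsLinearCondition B) (p : G.L2 × G.L2)
    (hp : p ∈ G.laplacianGraph B hB) (h0 : p.1 = 0) : p.2 = 0 := by
  obtain ⟨f, f₁, f₂, hf, -, hp1, hp2⟩ := hp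
  ext1 e
  refine Lp.ext ?_
  have h1 : f e =ᵐ[volume.restrict (Icc 0 (G.len e))] 0 := by
    refine (hp1 e).symm.trans ?_
    rw [h0]
    exact Lp.coeFn_zero _ _ _
  have h2 := (hf e).ae_zero (G.len_pos e) h1
  refine (hp2 e).trans ((h2.neg.trans ?_).trans (Lp.coeFn_zero _ _ _).symm)
  simp

/-- The operator `f ↦ -f''` in `L²(G)` with domain the functions which are edgewise in `H²` and
satisfy the linear vertex condition `B`. -/
def laplacian [Fintype E] (G : MetricGraph V E) (B : (E → ℝ → ℂ) → (E → ℝ → ℂ) → Prop)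
    (hB : IsLinearCondition B) : G.L2 →ₗ.[ℂ] G.L2 :=
  (G.laplacianGraph B hB).toLinearPMap

theorem laplacian_graph [Fintype E] (G : MetricGraph V E)
    (B : (E → ℝ → ℂ) → (E → ℝ → ℂ) → Prop) (hB : IsLinearCondition B) :
    (G.laplacian B hB).graph = G.laplacianGraph B hB :=
  Submodule.toLinearPMap_graph_eq _ (G.laplacianGraph_snd_eq_zero B hB)

/-- The standard Laplacian `-Δ_G` in `L²(G)`. -/
def standardLaplacian [Fintype E] (G : MetricGraph V E) : G.L2 →ₗ.[ℂ] G.L2 :=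
  G.laplacian G.StandardCondition G.isLinearCondition_standard

/-- The Dirichlet Laplacian `-Δ_G^D` in `L²(G)`. -/
def dirichletLaplacian [Fintype E] (G : MetricGraph V E) : G.L2 →ₗ.[ℂ] G.L2 :=
  G.laplacian G.DirichletCondition G.isLinearCondition_dirichlet

end MetricGraph

/-- The space `ker (T - z)` for an operator `T` defined on a subspace. -/
def LinearPMap.kerSub {H : Type*} [AddCommGroup H] [Module ℂ H] (T : H →ₗ.[ℂ] H) (z : ℂ) :
    Submodule ℂ H :=
  (LinearMap.ker (T.toFun - z • T.domain.subtype)).map T.domain.subtype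

/-- `lam 0 ≤ lam 1 ≤ lam 2 ≤ …` is a nondecreasing enumeration of all the eigenvalues of `T`, each
of them listed as often as its (finite) multiplicity `dim ker (T - z)`. -/
def IsEigenvalueEnumeration {H : Type*} [AddCommGroup H] [Module ℂ H] (T : H →ₗ.[ℂ] H)
    (lam : ℕ → ℝ) : Prop :=
  Monotone lam ∧ ∀ z : ℂ, FiniteDimensional ℂ (T.kerSub z) ∧
    {j : ℕ | (lam j : ℂ) = z}.encard = (Module.finrank ℂ (T.kerSub z) : ℕ∞)

end

noncomputable section

/-! Both operators come from the closed form ∫|x'|² on edgewise H¹ functions that are continuous on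
G, with or without the requirement of vanishing at the vertices. The form domains embed compactly,
so the operators have compact resolvents (`exists_isCompactResolvent_of_form`), and every
enumeration of eigenvalues comes with an orthonormal eigenbasis.

For the inequality let μ = ω² be a Dirichlet eigenvalue. On a tree the edge lengths are the
coboundary of a potential d, so u = exp(iωd) is continuous and solves -u'' = μu on all edges
(`IsTree.exists_wave`). Since |u| = 1 at the vertices, the boundary terms of u against itself cancel
on each edge; hence ∫|·'|² - μ∫|·|² vanishes at u, and u is null against every function vanishing at
the vertices. Adding u to the first k Dirichlet eigenfunctions gives a (k+1)-dimensional space on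
which this form is nonpositive, and the min-max argument applies
(`exists_standard_eigenfunction_of_le`).

In case of equality some nonzero f + ru from this space is a standard eigenfunction. Wronskians of
solutions whose vertex terms cancel are flows, and a tree carries no nonzero flow. If sin(ωL) ≠ 0 on
one edge, f has zero end derivatives there, and the Wronskian of f + ru with itself forces r = 0;
that of f with u then forces f = 0 (`IsTree.eq_zero_of_isStrongSolution`). So equality needs ωL ∈ πℤ
on all edges, which makes all lengths commensurable.

Conversely, commensurable lengths share a resonance ω. There the sines on single edges give
Dirichlet multiplicity at least |E|, and glued cosines give a standard eigenfunction without zeros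
at the vertices. A dimension count using |V| = |E| + 1 bounds the number of standard eigenvalues
below ω² (`not_lt_of_resonance`), and strictness fails. -/

theorem LinearPMap.mem_kerSub {H : Type*} [AddCommGroup H] [Module ℂ H] {T : H →ₗ.[ℂ] H} {z : ℂ}
    {x : H} : x ∈ T.kerSub z ↔ (x, z • x) ∈ T.graph := by
  rw [LinearPMap.kerSub, Submodule.mem_map, LinearPMap.mem_graph_iff]
  constructor
  · rintro ⟨y, hy, rfl⟩
    refine ⟨y, rfl, ?_⟩
    rw [LinearMap.mem_ker, LinearMap.sub_apply, sub_eq_zero] at hy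
    simpa using hy
  · rintro ⟨y, hy, hy'⟩
    refine ⟨y, ?_, hy⟩
    rw [LinearMap.mem_ker, LinearMap.sub_apply, sub_eq_zero]
    simp only [LinearPMap.toFun_eq_coe, LinearMap.smul_apply, Submodule.subtype_apply]
    rw [hy', hy]

/-! ### Operators with compact resolvent: enumerations and eigenbases -/

/-- `R` is the compact resolvent `(T + 1)⁻¹` of a nonnegative symmetric operator `T`. -/
structure IsCompactResolvent {H : Type*} [NormedAddCommGroup H] [InnerProductSpace ℂ H]
    (T : H →ₗ.[ℂ] H) (R : H →L[ℂ] H) : Prop where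
  isCompact : IsCompactOperator R
  isSymmetric : (R : H →ₗ[ℂ] H).IsSymmetric
  mem_graph_iff : ∀ x y, (x, y) ∈ T.graph ↔ R (x + y) = x
  nonneg : ∀ x y, (x, y) ∈ T.graph → 0 ≤ (inner ℂ x y).re

/-- A family of natural numbers with locally finite, infinite support is
the family of multiplicities of a nondecreasing sequence. -/
theorem exists_monotone_encard_eq (m : ℝ → ℕ) (hfin : ∀ C : ℝ, {z | m z ≠ 0 ∧ z ≤ C}.Finite)
    (hinf : {z | m z ≠ 0}.Infinite) :
    ∃ lam : ℕ → ℝ, Monotone lam ∧ ∀ z, {j | lam j = z}.encard = m z := by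
  classical
  -- Each value is repeated according to its multiplicity, ordered lexicographically. All initial
  -- segments are finite and the order is infinite, so it is isomorphic to ℕ.
  let I := Σₗ z : ℝ, Fin (m z)
  let val : I → ℝ := fun i => (ofLex i).1
  have hval : ∀ i : I, m (val i) ≠ 0 := fun i h => by
    have := (ofLex i).2.2
    change (_ : ℕ) < m (val i) at this
    omega
  have hmono : Monotone val := by
    intro i j hij
    rcases (Sigma.Lex.le_def.1 hij) with h | ⟨h, -⟩
    · exact h.le
    · exact h.le
  have hsub : ∀ i : I, (Iic i).Finite := by
    intro i
    have : (Sigma.fst ⁻¹' {z | m z ≠ 0 ∧ z ≤ val i} : Set (Σ z : ℝ, Fin (m z))).Finite := by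
      refine Set.Finite.preimage' (hfin _) fun z _ => ?_
      refine (Set.finite_range fun k : Fin (m z) => (⟨z, k⟩ : Σ z : ℝ, Fin (m z))).subset ?_
      rintro ⟨z', k⟩ rfl
      exact ⟨k, rfl⟩
    refine (this.image toLex).subset ?_
    intro j hj
    exact ⟨ofLex j, ⟨hval j, hmono hj⟩, rfl⟩
  have hIinf : Infinite I := by
    have : (Set.range val).Infinite := by
      refine hinf.mono fun z hz => ⟨toLex ⟨z, ⟨0, Nat.pos_of_ne_zero hz⟩⟩, rfl⟩
    exact Set.infinite_univ_iff.1 ((Set.image_univ ▸ this).of_image val)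
  let : LocallyFiniteOrder I := LocallyFiniteOrder.ofFiniteIcc fun a b =>
    (hsub b).subset Icc_subset_Iic_self
  have : NoMaxOrder I := ⟨fun a => by
    by_contra! h
    exact Set.infinite_univ (α := I) ((hsub a).subset fun x _ => not_lt.1 (h x))⟩
  obtain ⟨i0⟩ : Nonempty I := inferInstance
  obtain ⟨b, hb, hbmin⟩ := (hsub i0).exists_minimal ⟨i0, mem_Iic.2 le_rfl⟩
  have hbot : ∀ a, b ≤ a := by
    intro a
    rcases le_total a b with h | h
    · exact hbmin (le_trans h hb) h
    · exact h
  let : OrderBot I := { bot := b, bot_le := hbot }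
  let : SuccOrder I := LinearLocallyFiniteOrder.succOrder I
  let : PredOrder I := LinearLocallyFiniteOrder.predOrder I
  let e : I ≃o ℕ := orderIsoNatOfLinearSuccPredArch
  refine ⟨fun n => val (e.symm n), hmono.comp e.symm.monotone, fun z => ?_⟩
  have h1 : {j | val (e.symm j) = z} = e '' {i | val i = z} := by
    ext j
    constructor
    · intro h
      exact ⟨e.symm j, h, by simp⟩
    · rintro ⟨i, hi, rfl⟩
      simpa using hi
  rw [h1, e.injective.encard_image]
  have h2 : {i : I | val i = z} = Set.range fun k : Fin (m z) => (toLex ⟨z, k⟩ : I) := by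
    ext i
    constructor
    · rintro rfl
      exact ⟨(ofLex i).2, rfl⟩
    · rintro ⟨k, rfl⟩
      rfl
  rw [h2, ← Set.image_univ, Function.Injective.encard_image, Set.encard_univ]
  · simp
  · intro a b hab
    have := congrArg ofLex hab
    simpa using this

namespace IsCompactResolvent

variable {H : Type*} [NormedAddCommGroup H] [InnerProductSpace ℂ H]
  {T : H →ₗ.[ℂ] H} {R : H →L[ℂ] H}

theorem mem_kerSub_iff (h : IsCompactResolvent T R) {z : ℂ} {x : H} :
    x ∈ T.kerSub z ↔ (1 + z) • R x = x := by
  rw [LinearPMap.mem_kerSub, h.mem_graph_iff, ← map_smul, add_smul, one_smul]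

/-- If R x = 0, then (0, x) lies in the graph of T, and a graph is single-valued. -/
theorem eigenspace_zero (h : IsCompactResolvent T R) :
    Module.End.eigenspace (R : H →ₗ[ℂ] H) 0 = ⊥ := by
  rw [eq_bot_iff]
  intro x hx
  rw [Module.End.mem_eigenspace_iff] at hx
  have h1 : ((0 : H), x) ∈ T.graph := (h.mem_graph_iff _ _).2 (by simpa using hx)
  exact LinearPMap.graph_fst_eq_zero_snd T h1 rfl

/-- The value -1 is the only one at which the correspondence z ↦ (1 + z)⁻¹ with eigenvalues of R
breaks down; there the factor 1 + z kills R x. -/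
theorem kerSub_neg_one (h : IsCompactResolvent T R) : T.kerSub (-1) = ⊥ := by
  rw [eq_bot_iff]
  intro x hx
  rw [h.mem_kerSub_iff] at hx
  simpa [eq_comm] using hx

theorem kerSub_eq_eigenspace (h : IsCompactResolvent T R) {z : ℂ} (hz : z ≠ -1) :
    T.kerSub z = Module.End.eigenspace (R : H →ₗ[ℂ] H) (1 + z)⁻¹ := by
  have hz' : 1 + z ≠ 0 := fun h0 => hz (by linear_combination h0)
  ext x
  rw [h.mem_kerSub_iff, Module.End.mem_eigenspace_iff, ContinuousLinearMap.coe_coe,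
    eq_inv_smul_iff₀ hz']

theorem eigenspace_eq_kerSub (h : IsCompactResolvent T R) {ν : ℂ} (hν : ν ≠ 0) :
    Module.End.eigenspace (R : H →ₗ[ℂ] H) ν = T.kerSub (ν⁻¹ - 1) := by
  rw [h.kerSub_eq_eigenspace]
  · simp
  · intro h0
    exact inv_ne_zero hν (by linear_combination h0)

/-- Symmetry of R makes (1 + z)⁻¹ real, and nonnegativity of the form fixes the sign of z. -/
theorem exists_ofReal (h : IsCompactResolvent T R) {z : ℂ} (hz : T.kerSub z ≠ ⊥) :
    ∃ r : ℝ, 0 ≤ r ∧ z = r := by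
  obtain ⟨x, hx, hx0⟩ := Submodule.exists_mem_ne_zero_of_ne_bot hz
  have hz1 : z ≠ -1 := by
    rintro rfl
    exact hz h.kerSub_neg_one
  have hz' : 1 + z ≠ 0 := fun h0 => hz1 (by linear_combination h0)
  have hev : Module.End.HasEigenvalue (R : H →ₗ[ℂ] H) (1 + z)⁻¹ := by
    rw [Module.End.hasEigenvalue_iff, ← h.kerSub_eq_eigenspace hz1]
    exact hz
  have h1 := h.isSymmetric.conj_eigenvalue_eq_self hev
  rw [map_inv₀, inv_inj, map_add, map_one, add_right_inj, Complex.conj_eq_iff_real] at h1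
  obtain ⟨r, rfl⟩ := h1
  refine ⟨r, ?_, rfl⟩
  have h2 := h.nonneg _ _ (LinearPMap.mem_kerSub.1 hx)
  rw [inner_smul_right, inner_self_eq_norm_sq_to_K] at h2
  have h3 : ((r : ℂ) * ((‖x‖ : ℝ) : ℂ) ^ 2).re = r * ‖x‖ ^ 2 := by
    norm_cast
  have h4 : 0 ≤ r * ‖x‖ ^ 2 := by
    rw [← h3]; exact h2
  exact nonneg_of_mul_nonneg_left h4 (by positivity)

/-- Infinitely many eigenvalues in [0, C] would give orthonormal eigenvectors whose images under R
are pairwise at least (1 + C)⁻¹ apart, contradicting compactness. -/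
theorem finite_eigenvalues_le (h : IsCompactResolvent T R) (C : ℝ) :
    {r : ℝ | T.kerSub r ≠ ⊥ ∧ r ≤ C}.Finite := by
  by_contra hinf
  have hinf : {r : ℝ | T.kerSub r ≠ ⊥ ∧ r ≤ C}.Infinite := hinf
  let r : ℕ → ℝ := fun n => hinf.natEmbedding _ n
  have hrinj : Function.Injective r := fun a b hab =>
    (hinf.natEmbedding _).injective (Subtype.ext hab)
  have hr : ∀ n, T.kerSub (r n) ≠ ⊥ ∧ r n ≤ C := fun n => (hinf.natEmbedding _ n).2
  have hr0 : ∀ n, 0 ≤ r n := fun n => by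
    obtain ⟨s, hs, hs'⟩ := h.exists_ofReal (hr n).1
    rwa [Complex.ofReal_inj.1 hs']
  have hC : 0 ≤ C := (hr0 0).trans (hr 0).2
  choose x hx hx0 using fun n => Submodule.exists_mem_ne_zero_of_ne_bot (hr n).1
  let y : ℕ → H := fun n => ((‖x n‖⁻¹ : ℝ) : ℂ) • x n
  have hy : ∀ n, y n ∈ T.kerSub (r n) := fun n => Submodule.smul_mem _ _ (hx n)
  have hyn : ∀ n, ‖y n‖ = 1 := fun n => by
    have : ‖x n‖ ≠ 0 := norm_ne_zero_iff.2 (hx0 n)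
    simp [y, norm_smul, this]
  have hR : ∀ n, R (y n) = ((1 + r n)⁻¹ : ℂ) • y n := fun n => by
    have h1 := h.mem_kerSub_iff.1 (hy n)
    have h2 : (1 + r n : ℂ) ≠ 0 := by
      have : (1 + r n : ℝ) ≠ 0 := by have := hr0 n; positivity
      exact_mod_cast this
    rw [eq_inv_smul_iff₀ h2, h1]
  have horth : ∀ m n, m ≠ n → inner ℂ (y m) (y n) = 0 := fun m n hmn => by
    have hne : ∀ k, (r k : ℂ) ≠ -1 := fun k hk => by
      have : r k = -1 := by exact_mod_cast hk
      linarith [hr0 k]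
    refine h.isSymmetric.orthogonalFamily_eigenspaces (i := (1 + r m : ℂ)⁻¹)
      (j := (1 + r n : ℂ)⁻¹) ?_ ⟨y m, ?_⟩ ⟨y n, ?_⟩
    · intro h0
      rw [inv_inj, add_right_inj, Complex.ofReal_inj] at h0
      exact hmn (hrinj h0)
    · rw [← h.kerSub_eq_eigenspace (hne m)]; exact hy m
    · rw [← h.kerSub_eq_eigenspace (hne n)]; exact hy n
  have hdist : ∀ m n, m ≠ n → (1 + C)⁻¹ ≤ ‖R (y m) - R (y n)‖ := by
    intro m n hmn
    have h1 : inner ℂ (R (y m)) (R (y n)) = 0 := by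
      rw [hR, hR, inner_smul_left, inner_smul_right, horth m n hmn]; simp
    have h2 : ‖R (y m) - R (y n)‖ ^ 2 = ‖R (y m)‖ ^ 2 + ‖R (y n)‖ ^ 2 := by
      rw [@norm_sub_sq ℂ, h1]; simp
    have h3 : (1 + C)⁻¹ ≤ ‖R (y m)‖ := by
      have e1 : (1 + r m : ℂ)⁻¹ = (((1 + r m)⁻¹ : ℝ) : ℂ) := by push_cast; rfl
      have h0 := hr0 m
      rw [hR, norm_smul, hyn, mul_one, e1, Complex.norm_real, Real.norm_eq_abs,
        abs_of_nonneg (by positivity)]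
      exact inv_anti₀ (by positivity) (by linarith [(hr m).2])
    refine le_of_sq_le_sq ?_ (norm_nonneg _)
    rw [h2]
    have : ((1 + C)⁻¹) ^ 2 ≤ ‖R (y m)‖ ^ 2 := by gcongr
    nlinarith [sq_nonneg ‖R (y n)‖]
  have hcomp := IsCompactOperator.isCompact_closure_image_closedBall (f := (R : H →ₗ[ℂ] H))
    h.isCompact 1
  obtain ⟨a, -, φ, hφ, hlim⟩ := hcomp.tendsto_subseq (x := fun n => R (y n)) fun n =>
    subset_closure ⟨y n, by simp [hyn], rfl⟩
  have hcau := hlim.cauchySeq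
  rw [Metric.cauchySeq_iff] at hcau
  obtain ⟨N, hN⟩ := hcau (1 + C)⁻¹ (by positivity)
  have h1 := hN N le_rfl (N + 1) (Nat.le_succ N)
  rw [dist_eq_norm] at h1
  have h2 := hdist (φ N) (φ (N + 1)) (hφ.injective.ne (Nat.succ_ne_self N).symm)
  exact absurd h1 (not_lt.2 h2)

/-- The spectral subspace on which a vector lies is detected by its Fourier coefficients. -/
theorem mem_graph_of_coeff (h : IsCompactResolvent T R) {lam : ℕ → ℝ} {b : HilbertBasis ℕ ℂ H}
    (hb : ∀ j, (b j, (lam j : ℂ) • b j) ∈ T.graph) {μ : ℝ} {x : H}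
    (hx : ∀ j, inner ℂ (b j) x = 0 ∨ lam j = μ) : (x, (μ : ℂ) • x) ∈ T.graph := by
  rw [← LinearPMap.mem_kerSub, h.mem_kerSub_iff]
  apply b.repr.injective
  ext j
  rw [b.repr_apply_apply, b.repr_apply_apply, inner_smul_right]
  have h1 : (1 + lam j : ℂ) • R (b j) = b j := by
    have := (h.mem_graph_iff _ _).1 (hb j)
    rwa [map_add, map_smul, ← one_smul ℂ (R (b j)), smul_smul, ← add_smul, mul_one] at this
  have h2 : (1 + lam j : ℂ) ≠ 0 := by
    intro h0
    rw [h0, zero_smul] at h1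
    have := b.orthonormal.1 j
    rw [← h1, norm_zero] at this
    exact zero_ne_one this
  -- Symmetry of R moves the eigenvalue equation from `b j` to the coefficients of R x.
  have h3 : (1 + lam j : ℂ) * inner ℂ (b j) (R x) = inner ℂ (b j) x := by
    have h4 : inner ℂ (R (b j)) x = inner ℂ (b j) (R x) := h.isSymmetric _ _
    conv_rhs => rw [← h1]
    rw [inner_smul_left, h4, map_add, map_one, Complex.conj_ofReal]
  rcases hx j with h0 | h0
  · rw [h0] at h3 ⊢
    rw [(mul_eq_zero.1 h3).resolve_left h2, mul_zero]
  · rw [← h0, h3]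

variable [CompleteSpace H]

theorem finiteDimensional_kerSub (h : IsCompactResolvent T R) (z : ℂ) :
    FiniteDimensional ℂ (T.kerSub z) := by
  by_cases hz : z = -1
  · rw [hz, h.kerSub_neg_one]; infer_instance
  · rw [h.kerSub_eq_eigenspace hz]
    refine ContinuousLinearMap.finite_dimensional_eigenspace h.isCompact _ (inv_ne_zero ?_)
    intro h0
    exact hz (by linear_combination h0)

/-- The spectral theorem for R, transported to T: zero is not an eigenvalue of R, and the other
eigenspaces are kernels of T - r with r real. -/
theorem orthogonal_eq_bot (h : IsCompactResolvent T R) {W : Submodule ℂ H}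
    (hW : ∀ r : ℝ, T.kerSub r ≤ W) : Wᗮ = ⊥ := by
  rw [eq_bot_iff, ← ContinuousLinearMap.orthogonalComplement_iSup_eigenspaces_eq_bot h.isCompact
    h.isSymmetric]
  refine Submodule.orthogonal_le (iSup_le fun ν => ?_)
  by_cases hν : ν = 0
  · rw [hν]
    exact h.eigenspace_zero.le.trans bot_le
  · refine (h.eigenspace_eq_kerSub hν).le.trans ?_
    by_cases hb : T.kerSub (ν⁻¹ - 1) = ⊥
    · rw [hb]; exact bot_le
    · obtain ⟨r, -, hr⟩ := h.exists_ofReal hb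
      rw [hr]; exact hW r

/-- Finitely many finite-dimensional kernels would span a finite-dimensional, hence closed, subspace
with trivial orthogonal complement, that is, all of H. -/
theorem infinite_eigenvalues (h : IsCompactResolvent T R) (hH : ¬ FiniteDimensional ℂ H) :
    {r : ℝ | T.kerSub r ≠ ⊥}.Infinite := by
  intro hfin
  apply hH
  let W : Submodule ℂ H := ⨆ r ∈ {r : ℝ | T.kerSub r ≠ ⊥}, T.kerSub (r : ℂ)
  have : FiniteDimensional ℂ W := by
    have := h.finiteDimensional_kerSub
    have := hfin.to_subtype
    have : W = ⨆ r : {r : ℝ | T.kerSub r ≠ ⊥}, T.kerSub ((r : ℝ) : ℂ) := iSup_subtype'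
    rw [this]
    infer_instance
  have hW : Wᗮ = ⊥ := h.orthogonal_eq_bot fun r => by
    by_cases hb : T.kerSub (r : ℂ) = ⊥
    · rw [hb]; exact bot_le
    · exact le_iSup₂ (f := fun (r : ℝ) (_ : r ∈ {r : ℝ | T.kerSub r ≠ ⊥}) => T.kerSub (r : ℂ)) r hb
  have : W = ⊤ := by rwa [Submodule.orthogonal_eq_bot_iff] at hW
  exact Module.Finite.equiv ((LinearEquiv.ofEq _ _ this).trans Submodule.topEquiv)

theorem exists_enumeration (h : IsCompactResolvent T R) (hH : ¬ FiniteDimensional ℂ H) :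
    ∃ lam : ℕ → ℝ, IsEigenvalueEnumeration T lam := by
  have hm : ∀ z : ℂ, Module.finrank ℂ (T.kerSub z) ≠ 0 ↔ T.kerSub z ≠ ⊥ := fun z => by
    have := h.finiteDimensional_kerSub z
    rw [Ne, Submodule.finrank_eq_zero]
  obtain ⟨lam, hmono, hlam⟩ := exists_monotone_encard_eq
    (fun r => Module.finrank ℂ (T.kerSub r))
    (fun C => by simpa only [hm] using h.finite_eigenvalues_le C)
    (by simpa only [hm] using h.infinite_eigenvalues hH)
  refine ⟨lam, hmono, fun z => ⟨h.finiteDimensional_kerSub z, ?_⟩⟩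
  by_cases hb : T.kerSub z = ⊥
  · rw [hb, finrank_bot, Nat.cast_zero, Set.encard_eq_zero, Set.eq_empty_iff_forall_notMem]
    rintro j rfl
    have h1 := hlam (lam j)
    rw [hb, finrank_bot, Nat.cast_zero, Set.encard_eq_zero] at h1
    exact (Set.eq_empty_iff_forall_notMem.1 h1 j) rfl
  · obtain ⟨r, -, rfl⟩ := h.exists_ofReal hb
    simpa using hlam r

theorem exists_hilbertBasis (h : IsCompactResolvent T R) {lam : ℕ → ℝ}
    (hlam : IsEigenvalueEnumeration T lam) :
    ∃ b : HilbertBasis ℕ ℂ H, ∀ j, (b j, (lam j : ℂ) • b j) ∈ T.graph := by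
  have := h.finiteDimensional_kerSub
  -- The indices j with value z are as many as the dimension of the kernel, so they can label an
  -- orthonormal basis of it.
  have hequiv : ∀ z : ℂ, Nonempty
      (Fin (Module.finrank ℂ (T.kerSub z)) ≃ {j : ℕ | (lam j : ℂ) = z}) := fun z => by
    have h1 := (hlam.2 z).2
    have hfin : {j : ℕ | (lam j : ℂ) = z}.Finite := by
      rw [← Set.encard_lt_top_iff, h1]; exact ENat.natCast_lt_top _
    have := hfin.to_subtype
    refine ⟨(Finite.equivFinOfCardEq ?_).symm⟩
    rw [Nat.card_coe_set_eq, Set.ncard, h1, ENat.toNat_natCast]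
  let e z := (hequiv z).some
  let v : ∀ z : ℂ, {j : ℕ | (lam j : ℂ) = z} → H := fun z j =>
    (stdOrthonormalBasis ℂ (T.kerSub z) ((e z).symm j) : H)
  let w : ℕ → H := fun j => v (lam j) ⟨j, rfl⟩
  have hwv : ∀ z j (hj : (lam j : ℂ) = z), w j = v z ⟨j, hj⟩ := by
    rintro z j rfl; rfl
  have hmem : ∀ j, w j ∈ T.kerSub (lam j) := fun j => Subtype.coe_prop _
  have hne : ∀ j, (lam j : ℂ) ≠ -1 := fun j hj => by
    have h0 : (w j : H) = 0 := by
      have := hmem j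
      rwa [hj, h.kerSub_neg_one] at this
    have h1 : ‖w j‖ = 1 := (stdOrthonormalBasis ℂ (T.kerSub (lam j))).orthonormal.1 _
    rw [h0, norm_zero] at h1
    exact zero_ne_one h1
  have hw : Orthonormal ℂ w := by
    refine ⟨fun j => (stdOrthonormalBasis ℂ (T.kerSub (lam j))).orthonormal.1 _, ?_⟩
    intro i j hij
    by_cases hl : (lam i : ℂ) = lam j
    · rw [hwv _ i hl]
      refine (stdOrthonormalBasis ℂ (T.kerSub (lam j))).orthonormal.2 ?_
      intro h0
      have := (e (lam j)).symm.injective h0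
      exact hij (congrArg Subtype.val this)
    · refine h.isSymmetric.orthogonalFamily_eigenspaces (i := (1 + lam i : ℂ)⁻¹)
        (j := (1 + lam j : ℂ)⁻¹) ?_ ⟨w i, ?_⟩ ⟨w j, ?_⟩
      · intro h0
        rw [inv_inj, add_right_inj] at h0
        exact hl h0
      · rw [← h.kerSub_eq_eigenspace (hne i)]; exact hmem i
      · rw [← h.kerSub_eq_eigenspace (hne j)]; exact hmem j
  have hspan : (Submodule.span ℂ (Set.range w))ᗮ = ⊥ := by
    refine h.orthogonal_eq_bot fun r x hx => ?_
    have h1 := (stdOrthonormalBasis ℂ (T.kerSub (r : ℂ))).sum_repr ⟨x, hx⟩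
    have h2 := congrArg (T.kerSub (r : ℂ)).subtype h1
    rw [map_sum, Submodule.subtype_apply] at h2
    change _ = x at h2
    rw [← h2]
    refine Submodule.sum_mem _ fun k _ => ?_
    rw [map_smul]
    refine Submodule.smul_mem _ _ (Submodule.subset_span ⟨(e r k).1, ?_⟩)
    rw [hwv r _ (e r k).2]
    simp [v]
  refine ⟨HilbertBasis.mkOfOrthogonalEqBot hw hspan, fun j => ?_⟩
  rw [HilbertBasis.coe_mkOfOrthogonalEqBot]
  exact LinearPMap.mem_kerSub.1 (hmem j)

end IsCompactResolvent

/-! ### Variational estimate and closed forms -/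

/-- If the quadratic form of a vector `x` (with value `a` at `x`) dominates the sums
`∑ lam j |⟨b j, x⟩|²` and `x` is orthogonal to all `b j` with `lam j < μ`, then each coefficient
of `x` is controlled by `a - μ ‖x‖²`. -/
theorem HilbertBasis.sub_mul_norm_sq_le {H : Type*} [NormedAddCommGroup H] [InnerProductSpace ℂ H]
    (b : HilbertBasis ℕ ℂ H) {lam : ℕ → ℝ} {μ a : ℝ} {x : H}
    (ha : ∀ s : Finset ℕ, ∑ j ∈ s, lam j * ‖inner ℂ (b j) x‖ ^ 2 ≤ a)
    (hx : ∀ j, lam j < μ → inner ℂ (b j) x = 0) (k : ℕ) :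
    (lam k - μ) * ‖inner ℂ (b k) x‖ ^ 2 ≤ a - μ * ‖x‖ ^ 2 := by
  have hsum : HasSum (fun j => ‖inner ℂ (b j) x‖ ^ 2) (‖x‖ ^ 2) := by
    have h1 := (b.hasSum_inner_mul_inner x x).mapL Complex.reCLM
    have h2 : ∀ j, Complex.reCLM (inner ℂ x (b j) * inner ℂ (b j) x) =
        ‖inner ℂ (b j) x‖ ^ 2 := fun j => by
      rw [← inner_conj_symm x (b j), RCLike.conj_mul]
      norm_cast
    simp only [h2] at h1
    rw [inner_self_eq_norm_sq_to_K] at h1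
    convert! h1 using 1
    norm_cast
  -- By Parseval, a - μ ∑ over finite sets tends to a - μ ‖x‖². Each finite sum of (lam j - μ)|⟨b j,
  -- x⟩|² has nonnegative terms only, so it dominates its k-th term.
  have hlim := (hsum.mul_left μ).const_sub a
  refine ge_of_tendsto hlim ?_
  filter_upwards [Filter.eventually_ge_atTop {k}] with s hs
  have hks : k ∈ s := hs (Finset.mem_singleton_self k)
  have h1 : (lam k - μ) * ‖inner ℂ (b k) x‖ ^ 2 ≤
      ∑ j ∈ s, (lam j - μ) * ‖inner ℂ (b j) x‖ ^ 2 := by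
    refine Finset.single_le_sum (f := fun j => (lam j - μ) * ‖inner ℂ (b j) x‖ ^ 2)
      (fun j _ => ?_) hks
    by_cases hj : lam j < μ
    · simp [hx j hj]
    · exact mul_nonneg (by linarith) (sq_nonneg _)
  have h2 := ha s
  simp only [sub_mul, Finset.sum_sub_distrib] at h1
  linarith

/-- An operator given by a closed form with compactly embedded form domain has compact resolvent.
The form domain `K` consists of pairs `(x, x')`, and the form is `⟨z', x'⟩`. -/
theorem exists_isCompactResolvent_of_form {H : Type*} [NormedAddCommGroup H]
    [InnerProductSpace ℂ H] [CompleteSpace H] {K : Submodule ℂ (WithLp 2 (H × H))}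
    (hK : IsClosed (K : Set (WithLp 2 (H × H))))
    (hc : IsCompactOperator fun p : K => (p : WithLp 2 (H × H)).fst) {T : H →ₗ.[ℂ] H}
    (hT : ∀ x y, (x, y) ∈ T.graph ↔ ∃ x', WithLp.toLp 2 (x, x') ∈ K ∧
      ∀ z z', WithLp.toLp 2 (z, z') ∈ K → inner ℂ z' x' = inner ℂ z y) :
    ∃ R, IsCompactResolvent T R := by
  have := hK.completeSpace_coe
  let J : K →L[ℂ] H := WithLp.fstL 2 ℂ H H ∘L K.subtypeL
  -- K carries the inner product form + ⟨·,·⟩, so the adjoint of the embedding J solves the weak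
  -- equation of T + 1, and J J* is the resolvent.
  let J' : H →L[ℂ] K := ContinuousLinearMap.adjoint J
  have hJ' : ∀ (p : K) h, inner ℂ p (J' h) = inner ℂ (p : WithLp 2 (H × H)).fst h :=
    fun p h => ContinuousLinearMap.adjoint_inner_right J p h
  refine ⟨J ∘L J', hc.comp_clm J', fun x y => ?_, fun x y => ?_, fun x y h => ?_⟩
  · change inner ℂ (J (J' x)) y = inner ℂ x (J (J' y))
    exact (ContinuousLinearMap.adjoint_inner_right J (J' x) y).symm.trans
      (ContinuousLinearMap.adjoint_inner_left J (J' y) x)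
  · rw [hT]
    constructor
    · rintro ⟨x', hx, h⟩
      have h1 : J' (x + y) = ⟨_, hx⟩ := by
        refine ext_inner_left ℂ fun p => ?_
        rw [hJ', Submodule.coe_inner, WithLp.prod_inner_apply, inner_add_right]
        exact congrArg _ (h _ _ p.2).symm
      change J (J' (x + y)) = x
      rw [h1]
      rfl
    · intro h
      obtain ⟨⟨⟨z, z'⟩, hk⟩, hk'⟩ : ∃ k, J' (x + y) = k := ⟨_, rfl⟩
      have h0 : J (J' (x + y)) = x := h
      rw [hk'] at h0
      obtain rfl : z = x := h0
      refine ⟨z', hk, fun w w' hp => ?_⟩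
      have h1 := hJ' ⟨_, hp⟩ (z + y)
      rw [hk', Submodule.coe_inner, WithLp.prod_inner_apply, inner_add_right] at h1
      exact add_left_cancel h1
  · obtain ⟨x', hx, h⟩ := (hT x y).1 h
    rw [← h _ _ hx]
    exact inner_self_nonneg (𝕜 := ℂ)

/-! ### The Volterra operator on L²(0, ℓ) -/

/-- The Hilbert space `L²(0, ℓ)`. -/
abbrev EdgeL2 (ℓ : ℝ) : Type := Lp ℂ 2 (volume.restrict (Icc 0 ℓ))

namespace EdgeL2

variable {ℓ : ℝ}

theorem integrableOn (g : EdgeL2 ℓ) : IntegrableOn g (Icc 0 ℓ) :=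
  (Lp.memLp g).integrable (by norm_num)

theorem intervalIntegrable (g : EdgeL2 ℓ) {a b : ℝ} (ha : a ∈ Icc 0 ℓ) (hb : b ∈ Icc 0 ℓ) :
    IntervalIntegrable g volume a b := by
  rw [intervalIntegrable_iff']
  refine g.integrableOn.mono_set ?_
  rw [uIcc]
  exact Icc_subset_Icc (le_min ha.1 hb.1) (max_le ha.2 hb.2)

/-- The indicator function of `(a, b]` in `L²(0, ℓ)`. -/
def ind (ℓ a b : ℝ) : EdgeL2 ℓ :=
  indicatorConstLp 2 (measurableSet_Ioc : MeasurableSet (Ioc a b)) (measure_ne_top _ _) 1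

theorem inner_ind {a b : ℝ} (ha : 0 ≤ a) (hab : a ≤ b) (hb : b ≤ ℓ) (g : EdgeL2 ℓ) :
    inner ℂ (ind ℓ a b) g = ∫ s in a..b, g s := by
  rw [ind, L2.inner_indicatorConstLp_one, Measure.restrict_restrict measurableSet_Ioc,
    inter_eq_self_of_subset_left, intervalIntegral.integral_of_le hab]
  exact Ioc_subset_Icc_self.trans (Icc_subset_Icc ha hb)

theorem norm_ind_le {a b : ℝ} (hab : a ≤ b) : ‖ind ℓ a b‖ ≤ √(b - a) := by
  rw [ind, norm_indicatorConstLp (by norm_num) (by norm_num), Real.sqrt_eq_rpow, norm_one, one_mul,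
    ENNReal.toReal_ofNat]
  gcongr
  rw [measureReal_restrict_apply measurableSet_Ioc]
  refine (measureReal_mono inter_subset_left (by simp)).trans ?_
  rw [Real.volume_real_Ioc_of_le hab]

theorem norm_integral_le (g : EdgeL2 ℓ) {a b : ℝ} (ha : 0 ≤ a) (hab : a ≤ b) (hb : b ≤ ℓ) :
    ‖∫ s in a..b, g s‖ ≤ √(b - a) * ‖g‖ := by
  rw [← inner_ind ha hab hb]
  exact (norm_inner_le_norm _ _).trans (by gcongr; exact norm_ind_le hab)

theorem continuousOn_integral (g : EdgeL2 ℓ) :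
    ContinuousOn (fun x => ∫ s in 0..x, g s) (Icc 0 ℓ) := by
  refine (intervalIntegral.continuousOn_primitive_Icc g.integrableOn).congr fun x hx => ?_
  beta_reduce
  rw [intervalIntegral.integral_of_le hx.1, integral_Icc_eq_integral_Ioc]

theorem memLp_of_continuousOn {f : ℝ → ℂ} (hf : ContinuousOn f (Icc 0 ℓ)) :
    MemLp f 2 (volume.restrict (Icc 0 ℓ)) := by
  obtain ⟨C, hC⟩ := isCompact_Icc.exists_bound_of_continuousOn hf
  refine MemLp.of_bound (hf.aestronglyMeasurable measurableSet_Icc) C ?_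
  filter_upwards [ae_restrict_mem measurableSet_Icc] with x hx using hC x hx

theorem memLp_inner_ind (g : EdgeL2 ℓ) :
    MemLp (fun x => inner ℂ (ind ℓ 0 x) g) 2 (volume.restrict (Icc 0 ℓ)) :=
  memLp_of_continuousOn (g.continuousOn_integral.congr fun _ hx => inner_ind le_rfl hx.1 hx.2 g)

/-- The Volterra operator `(V g)(x) = ∫₀ˣ g` on `L²(0, ℓ)`. -/
def volterra (ℓ : ℝ) : EdgeL2 ℓ →L[ℂ] EdgeL2 ℓ :=
  LinearMap.mkContinuous
    { toFun := fun g => (memLp_inner_ind g).toLp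
      map_add' := fun f g => by
        rw [← MemLp.toLp_add]
        congr 1
        ext x
        simp [inner_add_right]
      map_smul' := fun c g => by
        rw [RingHom.id_apply, ← MemLp.toLp_const_smul]
        congr 1
        ext x
        simp [inner_smul_right] }
    (measureUnivNNReal (volume.restrict (Icc 0 ℓ)) ^ (2 : ENNReal).toReal⁻¹ * √ℓ) fun g => by
      rw [mul_assoc]
      refine Lp.norm_le_of_ae_bound (by positivity) ?_
      filter_upwards [(memLp_inner_ind g).coeFn_toLp, ae_restrict_mem measurableSet_Icc]
        with x hx hx'
      rw [LinearMap.coe_mk, AddHom.coe_mk, hx]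
      refine (norm_inner_le_norm _ _).trans ?_
      gcongr
      refine (norm_ind_le hx'.1).trans ?_
      gcongr
      linarith [hx'.2]

theorem volterra_ae_eq_inner (g : EdgeL2 ℓ) :
    volterra ℓ g =ᵐ[volume.restrict (Icc 0 ℓ)] fun x => inner ℂ (ind ℓ 0 x) g :=
  (memLp_inner_ind g).coeFn_toLp

theorem volterra_ae_eq (g : EdgeL2 ℓ) :
    volterra ℓ g =ᵐ[volume.restrict (Icc 0 ℓ)] fun x => ∫ s in 0..x, g s := by
  filter_upwards [volterra_ae_eq_inner g, ae_restrict_mem measurableSet_Icc] with x hx hx'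
  rw [hx, inner_ind le_rfl hx'.1 hx'.2]

/-- The constant function `1`. -/
def one (ℓ : ℝ) : EdgeL2 ℓ := ind ℓ 0 ℓ

theorem inner_one (hℓ : 0 ≤ ℓ) (g : EdgeL2 ℓ) : inner ℂ (one ℓ) g = ∫ s in 0..ℓ, g s :=
  inner_ind le_rfl hℓ le_rfl g

theorem ae_mem_Ioc : ∀ᵐ x ∂volume.restrict (Icc 0 ℓ), x ∈ Ioc 0 ℓ := by
  rw [← restrict_Ioc_eq_restrict_Icc]
  exact ae_restrict_mem measurableSet_Ioc

theorem one_ae_eq : one ℓ =ᵐ[volume.restrict (Icc 0 ℓ)] fun _ => 1 := by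
  filter_upwards [indicatorConstLp_coeFn (p := 2) (s := Ioc 0 ℓ) (hs := measurableSet_Ioc)
    (hμs := measure_ne_top (volume.restrict (Icc 0 ℓ)) _) (c := (1 : ℂ)), ae_mem_Ioc] with x hx hx'
  rw [one, ind, hx, indicator_of_mem hx']

theorem inner_one_one (hℓ : 0 ≤ ℓ) : inner ℂ (one ℓ) (one ℓ) = (ℓ : ℂ) := by
  rw [inner_one hℓ, intervalIntegral.integral_of_le hℓ, ← integral_Icc_eq_integral_Ioc,
    integral_congr_ae one_ae_eq, integral_const]
  simp [hℓ]

/-- Integration by parts: the sum of the Volterra operator and its adjoint has rank one. -/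
theorem inner_volterra_add (hℓ : 0 ≤ ℓ) (f g : EdgeL2 ℓ) :
    inner ℂ (volterra ℓ f) g + inner ℂ f (volterra ℓ g) =
      inner ℂ f (one ℓ) * inner ℂ (one ℓ) g := by
  set μ := volume.restrict (Icc 0 ℓ) with hμ
  have hf : Integrable (fun s => (starRingEnd ℂ) (f s)) μ :=
    RCLike.conjCLE.toContinuousLinearMap.integrable_comp (𝕜 := ℝ)
      ((Lp.memLp f).integrable (by norm_num))
  have hg : Integrable g μ := (Lp.memLp g).integrable (by norm_num)
  have hone : ∀ h : EdgeL2 ℓ, inner ℂ (one ℓ) h = ∫ s, h s ∂μ := fun h => by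
    rw [inner_one hℓ, intervalIntegral.integral_of_le hℓ, hμ, integral_Icc_eq_integral_Ioc]
  have hprod : Integrable (fun p : ℝ × ℝ => (starRingEnd ℂ) (f p.1) * g p.2) (μ.prod μ) :=
    hf.mul_prod hg
  have hmeas : MeasurableSet {p : ℝ × ℝ | p.1 ≤ p.2} :=
    measurableSet_le measurable_fst measurable_snd
  have hV : ∀ (h : ℝ → ℂ), ∀ x ∈ Icc 0 ℓ, ∫ s in 0..x, h s = ∫ s, (Iic x).indicator h s ∂μ := by
    intro h x hx
    rw [integral_indicator measurableSet_Iic, hμ, Measure.restrict_restrict measurableSet_Iic,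
      intervalIntegral.integral_of_le hx.1, ← integral_Icc_eq_integral_Ioc]
    congr 2
    ext s
    simp only [mem_Icc, mem_inter_iff, mem_Iic]
    exact ⟨fun h => ⟨h.2, h.1, h.2.trans hx.2⟩, fun h => ⟨h.2.1, h.1⟩⟩
  -- The same integral over the half-open range s < x: with `hV` for one summand and this for the
  -- other, Fubini yields the exactly complementary regions p.1 ≤ p.2 and p.2 < p.1 of the square.
  have hV' : ∀ (h : ℝ → ℂ), ∀ x ∈ Icc 0 ℓ, ∫ s in 0..x, h s = ∫ s, (Iio x).indicator h s ∂μ := by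
    intro h x hx
    rw [hV h x hx, integral_indicator measurableSet_Iic, integral_indicator measurableSet_Iio, hμ,
      Measure.restrict_restrict measurableSet_Iic, Measure.restrict_restrict measurableSet_Iio]
    refine setIntegral_congr_set (Filter.EventuallyEq.inter Iio_ae_eq_Iic.symm
      (Filter.EventuallyEq.refl _ _))
  have h1 : inner ℂ (volterra ℓ f) g =
      ∫ p in {p : ℝ × ℝ | p.1 ≤ p.2}, (starRingEnd ℂ) (f p.1) * g p.2 ∂(μ.prod μ) := by
    rw [← integral_indicator hmeas, integral_prod_symm _ (hprod.indicator hmeas), L2.inner_def]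
    refine integral_congr_ae ?_
    filter_upwards [volterra_ae_eq f, ae_restrict_mem measurableSet_Icc] with x hx hx'
    rw [hx, RCLike.inner_apply', hV _ x hx', ← integral_conj, ← integral_mul_const]
    congr 1
    ext s
    by_cases hs : s ≤ x <;> simp [indicator, hs]
  have h2 : inner ℂ f (volterra ℓ g) =
      ∫ p in {p : ℝ × ℝ | p.1 ≤ p.2}ᶜ, (starRingEnd ℂ) (f p.1) * g p.2 ∂(μ.prod μ) := by
    rw [← integral_indicator hmeas.compl, integral_prod _ (hprod.indicator hmeas.compl),
      L2.inner_def]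
    refine integral_congr_ae ?_
    filter_upwards [volterra_ae_eq g, ae_restrict_mem measurableSet_Icc] with x hx hx'
    rw [hx, RCLike.inner_apply', hV' _ x hx', ← integral_const_mul]
    congr 1
    ext s
    by_cases hs : s < x <;> simp [indicator, hs]
  rw [h1, h2, integral_add_compl hmeas hprod, integral_prod_mul (fun s => (starRingEnd ℂ) (f s)) g,
    hone, ← inner_conj_symm f, hone,
    integral_conj]

/-- The Volterra operator is quasinilpotent. -/
theorem eq_zero_of_eq_smul_volterra (hℓ : 0 < ℓ) {z : ℂ} {g : EdgeL2 ℓ}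
    (hg : g = z • volterra ℓ g) : g = 0 := by
  -- A continuous representative on all of ℝ, so that its primitive is differentiable everywhere and
  -- Grönwall's inequality with zero initial value applies.
  let G : ℝ → ℂ := IccExtend hℓ.le ((Icc 0 ℓ).domRestrict fun x => z * ∫ s in 0..x, g s)
  have hGc : Continuous G :=
    (continuousOn_const.mul g.continuousOn_integral).domRestrict.Icc_extend'
  have hGx : ∀ x ∈ Icc 0 ℓ, G x = z * ∫ s in 0..x, g s := fun x hx => by
    simp only [G]
    rw [IccExtend_of_mem _ _ hx, domRestrict_apply]
  have hae : g =ᵐ[volume.restrict (Icc 0 ℓ)] G := by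
    filter_upwards [(Lp.ext_iff.1 hg), Lp.coeFn_smul z (volterra ℓ g), volterra_ae_eq g,
      ae_restrict_mem measurableSet_Icc] with x h1 h2 h3 h4
    rw [h1, h2, Pi.smul_apply, h3, smul_eq_mul, hGx x h4]
  have hint : ∀ x ∈ Icc 0 ℓ, ∫ s in 0..x, g s = ∫ s in 0..x, G s := fun x hx => by
    refine intervalIntegral.integral_congr_ae_restrict ?_
    rw [uIoc_of_le hx.1]
    exact ae_restrict_of_ae_restrict_of_subset
      (Ioc_subset_Icc_self.trans (Icc_subset_Icc_right hx.2)) hae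
  have hder : ∀ x, HasDerivAt (fun x => ∫ s in 0..x, G s) (G x) x := fun x =>
    (hGc.integral_hasStrictDerivAt 0 x).hasDerivAt
  have hzero : ∀ x ∈ Icc 0 ℓ, ∫ s in 0..x, G s = 0 := fun x hx => by
    have h1 := norm_le_gronwallBound_of_norm_deriv_right_le (f := fun x => ∫ s in 0..x, G s)
      (f' := G) (δ := 0) (K := ‖z‖) (ε := 0) (a := 0) (b := ℓ)
      (fun x _ => (hder x).continuousAt.continuousWithinAt)
      (fun x _ => (hder x).hasDerivWithinAt) (by simp)
      (fun x hx => by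
        rw [hGx x (Ico_subset_Icc_self hx), hint x (Ico_subset_Icc_self hx), norm_mul, add_zero])
      x hx
    rw [gronwallBound_ε0_δ0] at h1
    exact norm_le_zero_iff.1 h1
  rw [Lp.eq_zero_iff_ae_eq_zero]
  filter_upwards [hae, ae_restrict_mem measurableSet_Icc] with x h1 h2
  rw [h1, hGx x h2, hint x h2, hzero x h2, mul_zero, Pi.zero_apply]

/-- The continuous representative a + ∫₀ˣ g vanishes identically; x = 0 gives a, and differentiation
gives g. Hence an H¹ function determines its initial value and its derivative. -/
theorem eq_zero_of_smul_one_add_volterra (hℓ : 0 < ℓ) {a : ℂ} {g : EdgeL2 ℓ}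
    (h : a • one ℓ + volterra ℓ g = 0) : a = 0 ∧ g = 0 := by
  have hae : (fun x => a + ∫ s in 0..x, g s) =ᵐ[volume.restrict (Icc 0 ℓ)] 0 := by
    filter_upwards [Lp.ext_iff.1 h, Lp.coeFn_add (a • one ℓ) (volterra ℓ g),
      Lp.coeFn_smul a (one ℓ), one_ae_eq, volterra_ae_eq g,
      Lp.coeFn_zero ℂ 2 (volume.restrict (Icc 0 ℓ))] with x h1 h2 h3 h4 h5 h6
    rw [h2, Pi.add_apply, h3, Pi.smul_apply, h4, h5, h6] at h1
    simpa using h1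
  have hall := Measure.eqOn_Icc_of_ae_eq volume hℓ.ne hae
    (continuousOn_const.add g.continuousOn_integral) continuousOn_const
  have ha : a = 0 := by simpa using hall ⟨le_rfl, hℓ.le⟩
  refine ⟨ha, ?_⟩
  rw [Lp.eq_zero_iff_ae_eq_zero]
  refine IsSobolevTwo.ae_zero_of_integral hℓ
    (g.intervalIntegrable ⟨le_rfl, hℓ.le⟩ ⟨hℓ.le, le_rfl⟩) fun x hx => ?_
  simpa [ha] using hall hx

theorem coeFn_sum {ι : Type*} (s : Finset ι) (f : ι → EdgeL2 ℓ) :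
    ⇑(∑ i ∈ s, f i) =ᵐ[volume.restrict (Icc 0 ℓ)] fun x => ∑ i ∈ s, f i x := by
  classical
  induction s using Finset.induction_on with
  | empty =>
    simp only [Finset.sum_empty]
    exact Lp.coeFn_zero _ _ _
  | insert i s hi ih =>
    rw [Finset.sum_insert hi]
    filter_upwards [Lp.coeFn_add (f i) (∑ i ∈ s, f i), ih] with x h1 h2
    rw [h1, Pi.add_apply, h2, Finset.sum_insert hi]

/-- Approximation of the Volterra operator by averages over step functions with step size `h`. -/
def stepVolterra (ℓ h : ℝ) (N : ℕ) : EdgeL2 ℓ →L[ℂ] EdgeL2 ℓ :=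
  ∑ k ∈ Finset.range N, (innerSL ℂ (ind ℓ 0 (k * h))).smulRight (ind ℓ (k * h) ((k + 1) * h))

theorem isCompactOperator_stepVolterra (ℓ h : ℝ) (N : ℕ) :
    IsCompactOperator (stepVolterra ℓ h N) := by
  have : stepVolterra ℓ h N ∈ compactOperator (RingHom.id ℂ) (EdgeL2 ℓ) (EdgeL2 ℓ) := by
    refine Submodule.sum_mem _ fun k _ => ?_
    change IsCompactOperator _
    have h1 : IsCompactOperator (innerSL ℂ (ind ℓ 0 (k * h))) :=
      isCompactOperator_of_locallyCompactSpace_dom (innerSL ℂ (ind ℓ 0 (k * h)))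
    exact h1.clm_comp ((1 : ℂ →L[ℂ] ℂ).smulRight (ind ℓ (k * h) ((k + 1) * h)))
  exact this

/-- For x in (kh, (k+1)h] the step operator returns ∫ over [0, kh]. The error is an integral over an
interval of length at most h, which Cauchy–Schwarz bounds by √h ‖g‖. -/
theorem norm_volterra_sub_stepVolterra_le (hℓ : 0 < ℓ) {N : ℕ} (hN : 0 < N) :
    ‖volterra ℓ - stepVolterra ℓ (ℓ / N) N‖ ≤
      measureUnivNNReal (volume.restrict (Icc 0 ℓ)) ^ (2 : ENNReal).toReal⁻¹ * √(ℓ / N) := by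
  set h := ℓ / N with hh
  have hNR : (0 : ℝ) < N := by exact_mod_cast hN
  have hpos : 0 < h := by positivity
  refine ContinuousLinearMap.opNorm_le_bound _ (by positivity) fun g => ?_
  rw [mul_assoc]
  refine Lp.norm_le_of_ae_bound (by positivity) ?_
  have hind : ∀ᵐ x ∂volume.restrict (Icc 0 ℓ), ∀ k : ℕ,
      ind ℓ (k * h) ((k + 1) * h) x = (Ioc (k * h) ((k + 1) * h)).indicator (fun _ => 1) x :=
    ae_all_iff.2 fun k => indicatorConstLp_coeFn
  have hsm : ∀ᵐ x ∂volume.restrict (Icc 0 ℓ), ∀ k : ℕ,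
      (inner ℂ (ind ℓ 0 (k * h)) g • ind ℓ (k * h) ((k + 1) * h) : EdgeL2 ℓ) x =
        inner ℂ (ind ℓ 0 (k * h)) g * ind ℓ (k * h) ((k + 1) * h) x :=
    ae_all_iff.2 fun k => Lp.coeFn_smul _ _
  filter_upwards [ae_mem_Ioc, hind, hsm, volterra_ae_eq g,
    Lp.coeFn_sub (volterra ℓ g) (stepVolterra ℓ h N g),
    coeFn_sum (Finset.range N) fun k : ℕ =>
      inner ℂ (ind ℓ 0 (k * h)) g • ind ℓ (k * h) ((k + 1) * h)] with x hx hi hs hv hsub hsum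
  obtain ⟨k, hk⟩ : ∃ k : ℕ, ⌈x / h⌉₊ = k + 1 :=
    Nat.exists_eq_succ_of_ne_zero (Nat.ceil_pos.2 (div_pos hx.1 hpos)).ne'
  have hk1 : k * h < x := by
    rw [← lt_div_iff₀ hpos]
    exact Nat.lt_ceil.1 (by omega)
  have hk2 : x ≤ (k + 1) * h := by
    rw [← div_le_iff₀ hpos]
    have := Nat.le_ceil (x / h)
    rw [hk] at this
    exact_mod_cast this
  have hNh : N * h = ℓ := by rw [hh]; field_simp
  have hkN : k < N := by
    have h1 : (k : ℝ) * h < N * h := hk1.trans_le (hx.2.trans hNh.ge)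
    exact_mod_cast lt_of_mul_lt_mul_right h1 hpos.le
  have hstep : stepVolterra ℓ h N g x = ∫ s in 0..k * h, g s := by
    have e1 : stepVolterra ℓ h N g = ∑ k ∈ Finset.range N,
        inner ℂ (ind ℓ 0 (k * h)) g • ind ℓ (k * h) ((k + 1) * h) := by
      simp [stepVolterra]
    rw [e1, hsum, Finset.sum_eq_single k]
    · rw [hs, hi, indicator_of_mem (show x ∈ Ioc _ _ from ⟨hk1, hk2⟩), mul_one,
        inner_ind le_rfl (by positivity) (hk1.le.trans hx.2)]
    · intro j _ hjk
      rw [hs, hi, indicator_of_notMem, mul_zero]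
      rintro ⟨h1, h2⟩
      have h3 : (j : ℝ) < k + 1 := lt_of_mul_lt_mul_right (h1.trans_le hk2) hpos.le
      have h4 : (k : ℝ) < j + 1 := lt_of_mul_lt_mul_right (hk1.trans_le h2) hpos.le
      norm_cast at h3 h4
      omega
    · intro h0
      exact absurd (Finset.mem_range.2 hkN) h0
  have hmem : (k : ℝ) * h ∈ Icc 0 ℓ := ⟨by positivity, hk1.le.trans hx.2⟩
  rw [sub_apply, hsub, Pi.sub_apply, hv, hstep,
    intervalIntegral.integral_interval_sub_left
      (g.intervalIntegrable ⟨le_rfl, hℓ.le⟩ (Ioc_subset_Icc_self hx))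
      (g.intervalIntegrable ⟨le_rfl, hℓ.le⟩ hmem)]
  refine (g.norm_integral_le hmem.1 hk1.le hx.2).trans ?_
  gcongr
  linarith

/-- A norm limit of finite-rank operators; N + 1 steps are used to avoid division by zero. -/
theorem isCompactOperator_volterra (hℓ : 0 < ℓ) : IsCompactOperator (volterra ℓ) := by
  refine isCompactOperator_of_tendsto (l := Filter.atTop)
    (F := fun N : ℕ => stepVolterra ℓ (ℓ / (N + 1 : ℕ)) (N + 1)) ?_
    (Filter.Eventually.of_forall fun N => isCompactOperator_stepVolterra _ _ _)
  rw [tendsto_iff_norm_sub_tendsto_zero]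
  refine squeeze_zero (fun _ => norm_nonneg _) (fun N => ?_)
    (g := fun N : ℕ => measureUnivNNReal (volume.restrict (Icc 0 ℓ)) ^ (2 : ENNReal).toReal⁻¹ *
      √(ℓ / (N + 1 : ℕ))) ?_
  · rw [norm_sub_rev]
    exact norm_volterra_sub_stepVolterra_le hℓ N.succ_pos
  · have h1 : Filter.Tendsto (fun N : ℕ => ℓ / ((N + 1 : ℕ) : ℝ)) Filter.atTop (nhds 0) :=
      (tendsto_const_div_atTop_nhds_zero_nat ℓ).comp (Filter.tendsto_add_atTop_nat 1)
    have h2 := (Real.continuous_sqrt.tendsto 0).comp h1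
    rw [Real.sqrt_zero] at h2
    simpa using h2.const_mul
      ((measureUnivNNReal (volume.restrict (Icc 0 ℓ)) : ℝ) ^ (2 : ENNReal).toReal⁻¹)

/-- The exponential function `x ↦ exp (i ω x)`. -/
def exp (ℓ ω : ℝ) : EdgeL2 ℓ :=
  (memLp_of_continuousOn (f := fun x : ℝ => Complex.exp (Complex.I * ω * x))
    (by fun_prop)).toLp

theorem exp_ae_eq (ω : ℝ) :
    exp ℓ ω =ᵐ[volume.restrict (Icc 0 ℓ)] fun x : ℝ => Complex.exp (Complex.I * ω * x) :=
  MemLp.coeFn_toLp _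

theorem integral_exp {ω : ℝ} {x : ℝ} (hx : x ∈ Icc 0 ℓ) :
    Complex.I * ω * ∫ s in 0..x, exp ℓ ω s = Complex.exp (Complex.I * ω * x) - 1 := by
  have h1 : ∫ s in 0..x, exp ℓ ω s = ∫ s in 0..x, Complex.exp (Complex.I * ω * s) := by
    refine intervalIntegral.integral_congr_ae_restrict ?_
    rw [uIoc_of_le hx.1]
    exact ae_restrict_of_ae_restrict_of_subset
      (Ioc_subset_Icc_self.trans (Icc_subset_Icc_right hx.2)) (exp_ae_eq ω)
  rw [h1]
  by_cases hω : ω = 0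
  · simp [hω]
  · have h2 : Complex.I * ω ≠ 0 := by simp [hω]
    rw [integral_exp_mul_complex h2]
    rw [mul_div_cancel₀ _ h2]
    simp

/-- Keeping the factor iω on the left avoids a division and includes ω = 0. -/
theorem smul_volterra_exp (ω : ℝ) :
    (Complex.I * ω) • volterra ℓ (exp ℓ ω) = exp ℓ ω - one ℓ := by
  refine Lp.ext ?_
  filter_upwards [Lp.coeFn_smul (Complex.I * ω) (volterra ℓ (exp ℓ ω)), volterra_ae_eq (exp ℓ ω),
    exp_ae_eq (ℓ := ℓ) ω, one_ae_eq (ℓ := ℓ), Lp.coeFn_sub (exp ℓ ω) (one ℓ),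
    ae_restrict_mem measurableSet_Icc] with x h1 h2 h3 h4 h5 h6
  rw [h1, Pi.smul_apply, h2, h5, Pi.sub_apply, h3, h4, smul_eq_mul, integral_exp h6]

theorem mul_inner_one_exp (hℓ : 0 ≤ ℓ) (ω : ℝ) :
    Complex.I * ω * inner ℂ (one ℓ) (exp ℓ ω) = Complex.exp (Complex.I * ω * ℓ) - 1 := by
  rw [inner_one hℓ, integral_exp ⟨hℓ, le_rfl⟩]

end EdgeL2

/-! ### Boundary data and Green's identities on one edge -/

/-- The element `x` of `L²(0, ℓ)` belongs to `H²(0, ℓ)` and satisfies `-x'' = y`; it takes the values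
`α` and `β` and its derivative the values `γ` and `δ` at the two ends. -/
structure EdgeData {ℓ : ℝ} (x y : EdgeL2 ℓ) (α β γ δ : ℂ) : Prop where
  eq_fst : x = α • EdgeL2.one ℓ + EdgeL2.volterra ℓ (γ • EdgeL2.one ℓ - EdgeL2.volterra ℓ y)
  right_value : β = α + inner ℂ (EdgeL2.one ℓ) (γ • EdgeL2.one ℓ - EdgeL2.volterra ℓ y)
  right_deriv : δ = γ - inner ℂ (EdgeL2.one ℓ) y

namespace EdgeData

variable {ℓ : ℝ} {x y x' y' : EdgeL2 ℓ} {α β γ δ α' β' γ' δ' : ℂ}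

theorem add (h : EdgeData x y α β γ δ) (h' : EdgeData x' y' α' β' γ' δ') :
    EdgeData (x + x') (y + y') (α + α') (β + β') (γ + γ') (δ + δ') where
  eq_fst := by
    rw [h.eq_fst, h'.eq_fst]
    simp only [add_smul, map_add, map_sub]
    abel
  right_value := by
    rw [h.right_value, h'.right_value]
    simp only [add_smul, map_add, inner_add_right, inner_sub_right]
    ring
  right_deriv := by
    rw [h.right_deriv, h'.right_deriv, inner_add_right]
    ring

theorem smul (c : ℂ) (h : EdgeData x y α β γ δ) :
    EdgeData (c • x) (c • y) (c * α) (c * β) (c * γ) (c * δ) where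
  eq_fst := by
    nth_rw 1 [h.eq_fst]
    simp only [smul_add, mul_smul, map_smul, smul_sub, map_sub]
  right_value := by
    rw [h.right_value]
    simp only [mul_smul, map_smul, inner_smul_right, inner_sub_right]
    ring
  right_deriv := by
    rw [h.right_deriv, inner_smul_right]
    ring

protected theorem zero (ℓ : ℝ) : EdgeData (0 : EdgeL2 ℓ) 0 0 0 0 0 where
  eq_fst := by simp
  right_value := by simp
  right_deriv := by simp

/-- Green's first identity. -/
theorem green_first (hℓ : 0 ≤ ℓ) (h : EdgeData x y α β γ δ) (a : ℂ) (q : EdgeL2 ℓ) :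
    inner ℂ q (γ • EdgeL2.one ℓ - EdgeL2.volterra ℓ y) -
      inner ℂ (a • EdgeL2.one ℓ + EdgeL2.volterra ℓ q) y =
      starRingEnd ℂ (a + inner ℂ (EdgeL2.one ℓ) q) * δ - starRingEnd ℂ a * γ := by
  have h1 := EdgeL2.inner_volterra_add hℓ q y
  rw [h.right_deriv, map_add, inner_conj_symm, inner_add_left, inner_sub_right, inner_smul_left,
    inner_smul_right]
  linear_combination -h1

/-- Green's second identity. -/
theorem green (hℓ : 0 ≤ ℓ) (h : EdgeData x y α β γ δ) (h' : EdgeData x' y' α' β' γ' δ') :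
    inner ℂ x y' - inner ℂ y x' =
      starRingEnd ℂ α * γ' - starRingEnd ℂ γ * α' - (starRingEnd ℂ β * δ' - starRingEnd ℂ δ * β') :=
    by
  -- The first identity is used twice with the roles exchanged; after conjugation of one copy the
  -- derivative terms cancel.
  have h1 := h'.green_first hℓ α (γ • EdgeL2.one ℓ - EdgeL2.volterra ℓ y)
  have h2 := congrArg (starRingEnd ℂ)
    (h.green_first hℓ α' (γ' • EdgeL2.one ℓ - EdgeL2.volterra ℓ y'))
  rw [← h.eq_fst, ← h.right_value] at h1
  rw [← h'.eq_fst, ← h'.right_value] at h2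
  simp only [map_sub, map_mul, inner_conj_symm, Complex.conj_conj] at h1 h2
  linear_combination h2 - h1

theorem exp (hℓ : 0 ≤ ℓ) (ω : ℝ) :
    EdgeData (EdgeL2.exp ℓ ω) (((ω ^ 2 : ℝ) : ℂ) • EdgeL2.exp ℓ ω) 1
      (Complex.exp (Complex.I * ω * ℓ)) (Complex.I * ω)
      (Complex.I * ω * Complex.exp (Complex.I * ω * ℓ)) := by
  have hI : ((ω ^ 2 : ℝ) : ℂ) = -(Complex.I * ω * (Complex.I * ω)) := by
    push_cast
    linear_combination (ω : ℂ) ^ 2 * Complex.I_sq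
  have h1 : (Complex.I * ω) • EdgeL2.one ℓ -
      EdgeL2.volterra ℓ (((ω ^ 2 : ℝ) : ℂ) • EdgeL2.exp ℓ ω) =
        (Complex.I * ω) • EdgeL2.exp ℓ ω := by
    rw [hI, map_smul, neg_smul, mul_smul (Complex.I * ω : ℂ) (Complex.I * ω : ℂ),
      EdgeL2.smul_volterra_exp, smul_sub]
    abel
  refine ⟨?_, ?_, ?_⟩
  · rw [h1, map_smul, EdgeL2.smul_volterra_exp, one_smul, add_sub_cancel]
  · rw [h1, inner_smul_right, EdgeL2.mul_inner_one_exp hℓ]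
    ring
  · rw [inner_smul_right, hI]
    linear_combination -(Complex.I * ω) * EdgeL2.mul_inner_one_exp hℓ ω

end EdgeData

/-- Elements of `L²(0, ℓ)` in terms of Sobolev representatives. -/
theorem edgeData_iff_exists_isSobolevTwo {ℓ : ℝ} (hℓ : 0 < ℓ) {x y : EdgeL2 ℓ} {α β γ δ : ℂ} :
    EdgeData x y α β γ δ ↔ ∃ f f₁ f₂ : ℝ → ℂ, IsSobolevTwo ℓ f f₁ f₂ ∧
      x =ᵐ[volume.restrict (Icc 0 ℓ)] f ∧ y =ᵐ[volume.restrict (Icc 0 ℓ)] -f₂ ∧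
      f 0 = α ∧ f ℓ = β ∧ f₁ 0 = γ ∧ f₁ ℓ = δ := by
  constructor
  · intro h
    set p := γ • EdgeL2.one ℓ - EdgeL2.volterra ℓ y with hp
    have hpae : p =ᵐ[volume.restrict (Icc 0 ℓ)] fun x => γ - ∫ s in 0..x, y s := by
      filter_upwards [Lp.coeFn_sub (γ • EdgeL2.one ℓ) (EdgeL2.volterra ℓ y),
        Lp.coeFn_smul γ (EdgeL2.one ℓ), EdgeL2.one_ae_eq (ℓ := ℓ), EdgeL2.volterra_ae_eq y]
        with x h1 h2 h3 h4
      rw [h1, Pi.sub_apply, h2, Pi.smul_apply, h3, h4, smul_eq_mul, mul_one]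
    have hint : ∀ x ∈ Icc 0 ℓ, ∫ s in 0..x, p s = ∫ s in 0..x, (γ - ∫ t in 0..s, y t) := by
      intro x hx
      refine intervalIntegral.integral_congr_ae_restrict ?_
      rw [uIoc_of_le hx.1]
      exact ae_restrict_of_ae_restrict_of_subset
        (Ioc_subset_Icc_self.trans (Icc_subset_Icc_right hx.2)) hpae
    refine ⟨fun x => α + ∫ s in 0..x, (γ - ∫ t in 0..s, y t), fun x => γ - ∫ t in 0..x, y t,
      fun x => -y x, ⟨(Lp.memLp y).neg, fun x _ => by simp, fun x _ => by simp [sub_eq_add_neg]⟩,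
      ?_, ?_, by simp, ?_, by simp, ?_⟩
    · filter_upwards [Lp.ext_iff.1 h.eq_fst, Lp.coeFn_add (α • EdgeL2.one ℓ) (EdgeL2.volterra ℓ p),
        Lp.coeFn_smul α (EdgeL2.one ℓ), EdgeL2.one_ae_eq (ℓ := ℓ), EdgeL2.volterra_ae_eq p,
        ae_restrict_mem measurableSet_Icc] with x h1 h2 h3 h4 h5 h6
      rw [h1, h2, Pi.add_apply, h3, Pi.smul_apply, h4, h5, smul_eq_mul, mul_one, hint x h6]
    · exact Filter.Eventually.of_forall fun x => by simp
    · rw [h.right_value, ← hp, EdgeL2.inner_one hℓ.le, hint ℓ ⟨hℓ.le, le_rfl⟩]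
    · rw [h.right_deriv, EdgeL2.inner_one hℓ.le]
  · rintro ⟨f, f₁, f₂, hf, hx, hy, rfl, rfl, rfl, rfl⟩
    have hℓ' : ℓ ∈ Icc 0 ℓ := ⟨hℓ.le, le_rfl⟩
    have hyint : ∀ x ∈ Icc 0 ℓ, ∫ s in 0..x, y s = f₁ 0 - f₁ x := by
      intro x hx
      rw [hf.deriv_eq_integral x hx, sub_add_cancel_left, ← intervalIntegral.integral_neg]
      refine intervalIntegral.integral_congr_ae_restrict ?_
      rw [uIoc_of_le hx.1]
      exact ae_restrict_of_ae_restrict_of_subset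
        (Ioc_subset_Icc_self.trans (Icc_subset_Icc_right hx.2)) hy
    set p := f₁ 0 • EdgeL2.one ℓ - EdgeL2.volterra ℓ y with hp
    have hpae : p =ᵐ[volume.restrict (Icc 0 ℓ)] f₁ := by
      filter_upwards [Lp.coeFn_sub (f₁ 0 • EdgeL2.one ℓ) (EdgeL2.volterra ℓ y),
        Lp.coeFn_smul (f₁ 0) (EdgeL2.one ℓ), EdgeL2.one_ae_eq (ℓ := ℓ), EdgeL2.volterra_ae_eq y,
        ae_restrict_mem measurableSet_Icc] with x h1 h2 h3 h4 h5
      rw [h1, Pi.sub_apply, h2, Pi.smul_apply, h3, h4, smul_eq_mul, mul_one, hyint x h5]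
      ring
    have hint : ∀ x ∈ Icc 0 ℓ, ∫ s in 0..x, p s = f x - f 0 := by
      intro x hx
      rw [hf.eq_integral x hx, add_sub_cancel_left]
      refine intervalIntegral.integral_congr_ae_restrict ?_
      rw [uIoc_of_le hx.1]
      exact ae_restrict_of_ae_restrict_of_subset
        (Ioc_subset_Icc_self.trans (Icc_subset_Icc_right hx.2)) hpae
    refine ⟨?_, ?_, ?_⟩
    · rw [← hp]
      refine Lp.ext ?_
      filter_upwards [hx, Lp.coeFn_add (f 0 • EdgeL2.one ℓ) (EdgeL2.volterra ℓ p),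
        Lp.coeFn_smul (f 0) (EdgeL2.one ℓ), EdgeL2.one_ae_eq (ℓ := ℓ), EdgeL2.volterra_ae_eq p,
        ae_restrict_mem measurableSet_Icc] with x h1 h2 h3 h4 h5 h6
      rw [h1, h2, Pi.add_apply, h3, Pi.smul_apply, h4, h5, smul_eq_mul, mul_one, hint x h6]
      ring
    · rw [← hp, EdgeL2.inner_one hℓ.le, hint ℓ hℓ']
      ring
    · rw [EdgeL2.inner_one hℓ.le, hyint ℓ hℓ']
      ring

/-! ### Potentials and flows on a tree -/

namespace MetricGraph

variable {V E : Type*} (G : MetricGraph V E)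

/-- The coboundary of a function on the vertices. -/
def coboundary : (V → ℂ) →ₗ[ℂ] (E → ℂ) where
  toFun c e := c (G.t e) - c (G.o e)
  map_add' c d := by ext e; simp; ring
  map_smul' a c := by ext e; simp; ring

theorem coboundary_apply (c : V → ℂ) (e : E) : G.coboundary c e = c (G.t e) - c (G.o e) := rfl

variable {G}

theorem eq_of_coboundary_eq_zero (hG : G.IsTree) {c : V → ℂ} (hc : G.coboundary c = 0) (v w : V) :
    c v = c w := by
  obtain ⟨p⟩ := hG.adjacency_isTree.connected.preconnected v w
  induction p with
  | nil => rfl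
  | cons h p ih =>
    rw [← ih]
    rw [adjacency, SimpleGraph.fromEdgeSet_adj] at h
    obtain ⟨⟨e, he⟩, -⟩ := h
    have h1 := congrFun hc e
    rw [coboundary_apply, Pi.zero_apply, sub_eq_zero] at h1
    rcases Sym2.eq_iff.1 he with ⟨h2, h3⟩ | ⟨h2, h3⟩
    · rw [← h2, ← h3, h1]
    · rw [← h2, ← h3, h1]

theorem IsTree.card_eq [Fintype V] [Fintype E] (hG : G.IsTree) :
    Fintype.card E + 1 = Fintype.card V := by
  classical
  have h1 : G.adjacency.edgeSet = Set.range fun e => s(G.o e, G.t e) := by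
    rw [adjacency, SimpleGraph.edgeSet_fromEdgeSet, sdiff_eq_left, Set.disjoint_left]
    rintro _ ⟨e, rfl⟩ h
    exact hG.no_loop e (by simpa using h)
  have hinj : Function.Injective fun e => s(G.o e, G.t e) := fun e e' h => hG.no_parallel e e' h
  have h2 := hG.adjacency_isTree.card_edgeFinset
  rw [SimpleGraph.edgeFinset_card, ← Nat.card_eq_fintype_card, h1,
    Nat.card_range_of_injective hinj, Nat.card_eq_fintype_card] at h2
  exact h2

/-- Connectedness leaves only constants in the kernel, so the rank is at least |V| - 1, which on a
tree is |E|. -/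
theorem surjective_coboundary [Fintype V] [Fintype E] (hG : G.IsTree) :
    Function.Surjective G.coboundary := by
  rw [← LinearMap.range_eq_top]
  apply Submodule.eq_top_of_finrank_eq
  have h1 := G.coboundary.finrank_range_add_finrank_ker
  have h2 : Module.finrank ℂ (LinearMap.ker G.coboundary) ≤ 1 := by
    refine (Submodule.finrank_mono ?_).trans
      ((finrank_span_le_card {fun _ : V => (1 : ℂ)}).trans (by simp))
    intro c hc
    rw [Submodule.mem_span_singleton]
    have v := hG.adjacency_isTree.connected.nonempty.some
    exact ⟨c v, funext fun w => by
      simpa using eq_of_coboundary_eq_zero hG (LinearMap.mem_ker.1 hc) v w⟩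
  have h3 := Submodule.finrank_le (LinearMap.range G.coboundary)
  rw [Module.finrank_fintype_fun_eq_card] at h1 h3
  rw [Module.finrank_fintype_fun_eq_card]
  have := hG.card_eq
  omega

/-- The edge lengths are the coboundary of a real potential. -/
theorem IsTree.exists_potential [Fintype V] [Fintype E] (hG : G.IsTree) :
    ∃ d : V → ℝ, ∀ e, d (G.t e) = d (G.o e) + G.len e := by
  obtain ⟨c, hc⟩ := surjective_coboundary hG fun e => (G.len e : ℂ)
  refine ⟨fun v => (c v).re, fun e => ?_⟩
  have := congrArg Complex.re (congrFun hc e)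
  rw [coboundary_apply, Complex.sub_re, Complex.ofReal_re] at this
  linarith

open Classical in
/-- The sum of the normal derivatives at the vertex `v` in terms of the derivatives `γ` at the
starting points and `δ` at the end points of the edges. -/
def flux [Fintype E] (G : MetricGraph V E) (γ δ : E → ℂ) (v : V) : ℂ :=
  ∑ e with G.t e = v, δ e - ∑ e with G.o e = v, γ e

/-- Summation over the edges of end point contributions is summation over the vertices. -/
theorem sum_mul_sub_mul [Fintype V] [Fintype E] (G : MetricGraph V E) (c : V → ℂ) (γ δ : E → ℂ) :
    ∑ e, (c (G.t e) * δ e - c (G.o e) * γ e) = ∑ v, c v * G.flux γ δ v := by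
  classical
  simp only [flux, mul_sub, Finset.sum_sub_distrib, Finset.mul_sum]
  congr 1
  · rw [← Finset.sum_fiberwise Finset.univ G.t]
    refine Finset.sum_congr rfl fun v _ => ?_
    refine Finset.sum_congr (by ext; simp) fun e he => ?_
    rw [(Finset.mem_filter.1 he).2]
  · rw [← Finset.sum_fiberwise Finset.univ G.o]
    refine Finset.sum_congr rfl fun v _ => ?_
    refine Finset.sum_congr (by ext; simp) fun e he => ?_
    rw [(Finset.mem_filter.1 he).2]

/-- There is no nonzero flow on a tree. -/
theorem IsTree.eq_zero_of_flux_eq_zero [Fintype V] [Fintype E] (hG : G.IsTree) {w : E → ℂ}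
    (hw : ∀ v, G.flux w w v = 0) : w = 0 := by
  classical
  ext e
  -- Summing the flow against a vertex function whose coboundary is the indicator of e isolates the
  -- value at e.
  obtain ⟨c, hc⟩ := surjective_coboundary hG (Pi.single e 1)
  have h1 := G.sum_mul_sub_mul c w w
  simp only [hw, mul_zero, Finset.sum_const_zero, ← sub_mul, ← coboundary_apply, hc] at h1
  simpa [Pi.single_apply] using h1

end MetricGraph

/-! ### The form domain, weak and strong solutions, and compactness -/

namespace MetricGraph

variable {V E : Type*} [Fintype E] (G : MetricGraph V E)

/-- The edgewise Volterra operator. -/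
def volterra : G.L2 →L[ℂ] G.L2 :=
  open Classical in
  ∑ e, (PiLp.continuousLinearEquiv 2 ℂ fun e => EdgeL2 (G.len e)).symm.toContinuousLinearMap ∘L
    ContinuousLinearMap.single ℂ (fun e => EdgeL2 (G.len e)) e ∘L EdgeL2.volterra (G.len e) ∘L
    PiLp.proj 2 (fun e => EdgeL2 (G.len e)) e

theorem volterra_apply (x : G.L2) (e : E) : G.volterra x e = EdgeL2.volterra (G.len e) (x e) := by
  classical
  simp only [volterra, FunLike.coe_sum, Finset.sum_apply, WithLp.ofLp_sum]
  rw [Finset.sum_eq_single e]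
  · simp
  · intro e' _ he'
    simp [he'.symm]
  · simp

theorem isCompactOperator_volterra : IsCompactOperator G.volterra := by
  classical
  have : G.volterra ∈ compactOperator (RingHom.id ℂ) G.L2 G.L2 := by
    refine Submodule.sum_mem _ fun e _ => ?_
    change IsCompactOperator _
    have h1 : IsCompactOperator (EdgeL2.volterra (G.len e) ∘L
        PiLp.proj 2 (fun e => EdgeL2 (G.len e)) e) :=
      (EdgeL2.isCompactOperator_volterra (G.len_pos e)).comp_clm _
    exact (h1.clm_comp (ContinuousLinearMap.single ℂ (fun e => EdgeL2 (G.len e)) e)).clm_comp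
      (PiLp.continuousLinearEquiv 2 ℂ fun e => EdgeL2 (G.len e)).symm.toContinuousLinearMap
  exact this

/-- The integrals over the edges. -/
def edgeIntegral : G.L2 →L[ℂ] (E → ℂ) :=
  ContinuousLinearMap.pi fun e =>
    innerSL ℂ (EdgeL2.one (G.len e)) ∘L PiLp.proj 2 (fun e => EdgeL2 (G.len e)) e

theorem edgeIntegral_apply (x : G.L2) (e : E) :
    G.edgeIntegral x e = inner ℂ (EdgeL2.one (G.len e)) (x e) := rfl

/-- The functions in `L²(G)` which are constant on each edge. -/
def edgeConst : (E → ℂ) →ₗ[ℂ] G.L2 where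
  toFun a := WithLp.toLp 2 fun e => a e • EdgeL2.one (G.len e)
  map_add' a b := by ext1 e; simp [add_smul]
  map_smul' a b := by ext1 e; simp [mul_smul]

theorem edgeConst_apply (a : E → ℂ) (e : E) :
    G.edgeConst a e = a e • EdgeL2.one (G.len e) := rfl

/-- The function `x` on `G` belongs edgewise to `H¹`, is continuous with vertex values `c`, and `y`
is its edgewise derivative. -/
def HasGradient (c : V → ℂ) (x y : G.L2) : Prop :=
  ∀ e, x e = c (G.o e) • EdgeL2.one (G.len e) + EdgeL2.volterra (G.len e) (y e) ∧
    c (G.t e) = c (G.o e) + inner ℂ (EdgeL2.one (G.len e)) (y e)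

variable {G}

namespace HasGradient

variable {c d : V → ℂ} {x y z w : G.L2}

theorem add (h : G.HasGradient c x y) (h' : G.HasGradient d z w) :
    G.HasGradient (c + d) (x + z) (y + w) := fun e => by
  simp only [PiLp.add_apply, Pi.add_apply]
  rw [(h e).1, (h' e).1, (h e).2, (h' e).2, add_smul, map_add, inner_add_right]
  exact ⟨by abel, by ring⟩

theorem smul (a : ℂ) (h : G.HasGradient c x y) : G.HasGradient (a • c) (a • x) (a • y) :=
  fun e => by
  simp only [PiLp.smul_apply, Pi.smul_apply]
  rw [map_smul, inner_smul_right, smul_eq_mul, smul_eq_mul, (h e).2, mul_add]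
  refine ⟨?_, rfl⟩
  rw [(h e).1, smul_add, mul_smul]

theorem zero : G.HasGradient 0 0 0 := fun e => by simp

theorem sum {ι : Type*} (s : Finset ι) {c : ι → V → ℂ} {x y : ι → G.L2}
    (h : ∀ i ∈ s, G.HasGradient (c i) (x i) (y i)) :
    G.HasGradient (∑ i ∈ s, c i) (∑ i ∈ s, x i) (∑ i ∈ s, y i) := by
  classical
  induction s using Finset.induction_on with
  | empty => simpa using zero
  | insert i s hi ih =>
    rw [Finset.sum_insert hi, Finset.sum_insert hi, Finset.sum_insert hi]
    exact (h i (Finset.mem_insert_self i s)).add (ih fun j hj => h j (Finset.mem_insert_of_mem hj))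

theorem eq_zero (h : G.HasGradient c 0 y) : (∀ e, c (G.o e) = 0) ∧ y = 0 := by
  have h1 := fun e => EdgeL2.eq_zero_of_smul_one_add_volterra (G.len_pos e) (h e).1.symm
  refine ⟨fun e => (h1 e).1, ?_⟩
  ext1 e
  exact (h1 e).2

end HasGradient

variable (G)

/-- The form domain: functions which are edgewise in `H¹`, continuous on `G` and vanish at the
vertices in `S`, together with their derivatives. -/
def formSpace (S : Set V) : Submodule ℂ (WithLp 2 (G.L2 × G.L2)) :=
  ((⨅ v ∈ S, LinearMap.ker (LinearMap.proj (R := ℂ) (φ := fun _ : V => ℂ) v)).map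
    ((G.edgeConst ∘ₗ LinearMap.funLeft ℂ ℂ G.o).prod G.coboundary)).comap
    (((WithLp.fstL 2 ℂ G.L2 G.L2 - G.volterra ∘L WithLp.sndL 2 ℂ G.L2 G.L2).prod
      (G.edgeIntegral ∘L WithLp.sndL 2 ℂ G.L2 G.L2)).toLinearMap)

theorem mem_formSpace {S : Set V} {p : WithLp 2 (G.L2 × G.L2)} :
    p ∈ G.formSpace S ↔ ∃ c : V → ℂ, (∀ v ∈ S, c v = 0) ∧ G.HasGradient c p.fst p.snd := by
  simp only [formSpace, Submodule.mem_comap, Submodule.mem_map, Submodule.mem_iInf,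
    LinearMap.mem_ker, LinearMap.proj_apply]
  refine exists_congr fun c => and_congr_right fun _ => ?_
  simp only [LinearMap.prod_apply, Prod.ext_iff, Function.prod, ContinuousLinearMap.coe_coe,
    ContinuousLinearMap.prod_apply, sub_apply, ContinuousLinearMap.comp_apply, LinearMap.comp_apply]
  constructor
  · rintro ⟨h1, h2⟩ e
    have h1 := congrArg (fun z : G.L2 => z e) h1
    have h2 := congrFun h2 e
    simp only [edgeConst_apply, PiLp.sub_apply, volterra_apply, edgeIntegral_apply,
      coboundary_apply, WithLp.fstL_apply, WithLp.sndL_apply, LinearMap.funLeft_apply] at h1 h2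
    exact ⟨by rw [h1]; abel, by rw [← h2]; ring⟩
  · intro h
    constructor
    · ext1 e
      simp only [edgeConst_apply, PiLp.sub_apply, volterra_apply,
        WithLp.fstL_apply, WithLp.sndL_apply, LinearMap.funLeft_apply]
      rw [(h e).1]; abel
    · ext e
      simp only [edgeIntegral_apply, coboundary_apply, WithLp.sndL_apply]
      rw [(h e).2]; ring

theorem toLp_mem_formSpace {S : Set V} {x y : G.L2} :
    WithLp.toLp 2 (x, y) ∈ G.formSpace S ↔ ∃ c : V → ℂ, (∀ v ∈ S, c v = 0) ∧ G.HasGradient c x y :=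
  G.mem_formSpace

/-- Membership says that the continuous linear map (x, x') ↦ (x - V x', edge integrals of x') lands
in a finite-dimensional, hence closed, subspace parametrized by vertex values. -/
theorem isClosed_formSpace [Fintype V] (S : Set V) :
    IsClosed (G.formSpace S : Set (WithLp 2 (G.L2 × G.L2))) :=
  IsClosed.preimage ((WithLp.fstL 2 ℂ G.L2 G.L2 - G.volterra ∘L WithLp.sndL 2 ℂ G.L2 G.L2).prod
    (G.edgeIntegral ∘L WithLp.sndL 2 ℂ G.L2 G.L2)).continuous
    (Submodule.closed_of_finiteDimensional
      ((⨅ v ∈ S, LinearMap.ker (LinearMap.proj (R := ℂ) (φ := fun _ : V => ℂ) v)).map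
        ((G.edgeConst ∘ₗ LinearMap.funLeft ℂ ℂ G.o).prod G.coboundary)))

/-- The pair `(x, y)` solves `-x'' = y` on the edges, with vertex values `c` and derivatives `γ`,
`δ` at the starting points and end points of the edges. -/
def HasEdgeData (x y : G.L2) (c : V → ℂ) (γ δ : E → ℂ) : Prop :=
  ∀ e, EdgeData (x e) (y e) (c (G.o e)) (c (G.t e)) (γ e) (δ e)

/-- `-x'' = y` with Dirichlet conditions at the vertices in `S` and Kirchhoff conditions at the
remaining vertices. -/
structure IsStrongSolution (S : Set V) (x y : G.L2) (c : V → ℂ) (γ δ : E → ℂ) : Prop where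
  hasEdgeData : G.HasEdgeData x y c γ δ
  dirichlet : ∀ v ∈ S, c v = 0
  kirchhoff : ∀ v ∉ S, G.flux γ δ v = 0

/-- `x` with derivative `x'` solves `-x'' = y` in the weak sense on the form domain. -/
structure IsWeakSolution (S : Set V) (x x' y : G.L2) : Prop where
  mem_formSpace : WithLp.toLp 2 (x, x') ∈ G.formSpace S
  inner_eq : ∀ z z', WithLp.toLp 2 (z, z') ∈ G.formSpace S → inner ℂ z' x' = inner ℂ z y

variable {G}

/-- The derivative of a solution. -/
def gradient (y : G.L2) (γ : E → ℂ) : G.L2 := G.edgeConst γ - G.volterra y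

theorem gradient_apply (y : G.L2) (γ : E → ℂ) (e : E) :
    gradient y γ e = γ e • EdgeL2.one (G.len e) - EdgeL2.volterra (G.len e) (y e) := by
  rw [gradient, PiLp.sub_apply, edgeConst_apply, volterra_apply]

theorem HasEdgeData.hasGradient {x y : G.L2} {c : V → ℂ} {γ δ : E → ℂ}
    (h : G.HasEdgeData x y c γ δ) : G.HasGradient c x (gradient y γ) := fun e => by
  rw [gradient_apply]
  exact ⟨(h e).eq_fst, (h e).right_value⟩

/-- Green's first identity on `G`. -/
theorem HasEdgeData.inner_gradient_sub [Fintype V] {x y z w : G.L2} {a c : V → ℂ} {γ δ : E → ℂ}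
    (h : G.HasEdgeData x y c γ δ) (h' : G.HasGradient a z w) :
    inner ℂ w (gradient y γ) - inner ℂ z y = ∑ v, starRingEnd ℂ (a v) * G.flux γ δ v := by
  rw [← G.sum_mul_sub_mul (fun v => starRingEnd ℂ (a v)), PiLp.inner_apply, PiLp.inner_apply,
    ← Finset.sum_sub_distrib]
  refine Finset.sum_congr rfl fun e _ => ?_
  have h1 := (h e).green_first (G.len_pos e).le (a (G.o e)) (w e)
  rw [← (h' e).1, ← (h' e).2] at h1
  rw [gradient_apply, h1]

theorem IsStrongSolution.isWeakSolution [Fintype V] {S : Set V} {x y : G.L2} {c : V → ℂ}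
    {γ δ : E → ℂ} (h : G.IsStrongSolution S x y c γ δ) :
    G.IsWeakSolution S x (gradient y γ) y where
  mem_formSpace := G.toLp_mem_formSpace.2 ⟨c, h.dirichlet, h.hasEdgeData.hasGradient⟩
  inner_eq z z' hp := by
    obtain ⟨a, ha, hp⟩ := G.toLp_mem_formSpace.1 hp
    rw [← sub_eq_zero, h.hasEdgeData.inner_gradient_sub hp]
    refine Finset.sum_eq_zero fun v _ => ?_
    by_cases hv : v ∈ S
    · rw [ha v hv, map_zero, zero_mul]
    · rw [h.kirchhoff v hv, mul_zero]

theorem IsWeakSolution.exists_isStrongSolution [Fintype V] {S : Set V} {x x' y : G.L2}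
    (h : G.IsWeakSolution S x x' y) : ∃ c γ δ, G.IsStrongSolution S x y c γ δ := by
  classical
  obtain ⟨c, hc, hx⟩ := G.toLp_mem_formSpace.1 h.mem_formSpace
  have hb : ∀ e, ∃ b : ℂ, x' e + EdgeL2.volterra (G.len e) (y e) = b • EdgeL2.one (G.len e) := by
    -- Weak solutions satisfy x' + V y = const on each edge: the left side is orthogonal to every q
    -- of mean zero, so it lies in the double orthogonal complement of the constants.
    intro e
    set one := EdgeL2.one (G.len e)
    have hmem : x' e + EdgeL2.volterra (G.len e) (y e) ∈ (ℂ ∙ one)ᗮᗮ := by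
      rw [Submodule.mem_orthogonal]
      intro q hq
      rw [Submodule.mem_orthogonal_singleton_iff_inner_right] at hq
      -- A mean-zero q on one edge has a primitive vanishing at both ends, so its extension by zero
      -- is an admissible test function for every S.
      have hp : WithLp.toLp 2 ((PiLp.single 2 e (EdgeL2.volterra (G.len e) q) : G.L2),
          (PiLp.single 2 e q : G.L2)) ∈ G.formSpace S := by
        refine G.toLp_mem_formSpace.2 ⟨0, fun _ _ => rfl, fun e' => ?_⟩
        by_cases he : e' = e
        · subst he
          simp only [PiLp.single_eq_same, Pi.zero_apply, zero_smul, zero_add]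
          exact ⟨trivial, hq.symm⟩
        · simp [he]
      have h1 := h.inner_eq _ _ hp
      simp only [PiLp.inner_apply] at h1
      rw [Finset.sum_eq_single e (fun e' _ he => by simp [he]) (by simp),
        Finset.sum_eq_single e (fun e' _ he => by simp [he]) (by simp)] at h1
      simp only [PiLp.single_eq_same] at h1
      have h2 := EdgeL2.inner_volterra_add (G.len_pos e).le q (y e)
      rw [← inner_conj_symm q (EdgeL2.one _), hq, map_zero, zero_mul] at h2
      rw [inner_add_right, h1, h2]
    rw [Submodule.orthogonal_orthogonal, Submodule.mem_span_singleton] at hmem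
    obtain ⟨b, hb⟩ := hmem
    exact ⟨b, hb.symm⟩
  choose γ hγ using hb
  have hγ' : x' = gradient y γ := by
    ext1 e
    rw [gradient_apply, ← hγ]; abel
  let δ : E → ℂ := fun e => γ e - inner ℂ (EdgeL2.one (G.len e)) (y e)
  have hdata : G.HasEdgeData x y c γ δ := fun e => by
    refine ⟨?_, ?_, rfl⟩
    · rw [(hx e).1, hγ', gradient_apply]
    · rw [(hx e).2, hγ', gradient_apply]
  refine ⟨c, γ, δ, hdata, hc, fun v hv => ?_⟩
  -- The edgewise affine hat function at v, admissible because v ∉ S; testing with it isolates the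
  -- flux at v.
  let a : V → ℂ := Pi.single v 1
  have hgrad : G.HasGradient a
      (G.edgeConst (fun e => a (G.o e)) +
        G.volterra (G.edgeConst fun e => (G.len e : ℂ)⁻¹ * (a (G.t e) - a (G.o e))))
      (G.edgeConst fun e => (G.len e : ℂ)⁻¹ * (a (G.t e) - a (G.o e))) := fun e => by
    refine ⟨?_, ?_⟩
    · rw [PiLp.add_apply, volterra_apply, edgeConst_apply]
    · have : (G.len e : ℂ) ≠ 0 := by exact_mod_cast (G.len_pos e).ne'
      rw [edgeConst_apply, inner_smul_right, EdgeL2.inner_one_one (G.len_pos e).le]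
      field_simp
      ring
  have h1 := hdata.inner_gradient_sub hgrad
  rw [← hγ'] at h1
  have h2 := h.inner_eq _ _ (G.toLp_mem_formSpace.2 ⟨a, fun w hw => by
    have : w ≠ v := fun h => hv (h ▸ hw)
    simp [a, this], hgrad⟩)
  rw [← sub_eq_zero] at h2
  rw [h2] at h1
  simpa [a, Pi.single_apply, apply_ite] using h1.symm

theorem exists_isWeakSolution_iff [Fintype V] {S : Set V} {x y : G.L2} :
    (∃ x', G.IsWeakSolution S x x' y) ↔ ∃ c γ δ, G.IsStrongSolution S x y c γ δ :=
  ⟨fun ⟨_, h⟩ => h.exists_isStrongSolution, fun ⟨_, _, _, h⟩ => ⟨_, h.isWeakSolution⟩⟩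

theorem mem_standardLaplacian_graph {x y : G.L2} :
    (x, y) ∈ G.standardLaplacian.graph ↔ ∃ c γ δ, G.IsStrongSolution ∅ x y c γ δ := by
  rw [standardLaplacian, laplacian_graph]
  constructor
  · rintro ⟨f, f₁, f₂, hf, ⟨⟨c, hc⟩, hB⟩, hx, hy⟩
    refine ⟨c, fun e => f₁ e 0, fun e => f₁ e (G.len e), fun e => ?_, by simp, fun v _ => hB v⟩
    exact (edgeData_iff_exists_isSobolevTwo (G.len_pos e)).2
      ⟨f e, f₁ e, f₂ e, hf e, hx e, hy e, (hc e).1, (hc e).2, rfl, rfl⟩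
  · rintro ⟨c, γ, δ, h, -, hB⟩
    choose f f₁ f₂ hf hx hy h1 h2 h3 h4 using
      fun e => (edgeData_iff_exists_isSobolevTwo (G.len_pos e)).1 (h e)
    refine ⟨f, f₁, f₂, hf, ⟨⟨c, fun e => ⟨h1 e, h2 e⟩⟩, fun v => ?_⟩, hx, hy⟩
    simpa only [normalDeriv, flux, h3, h4] using hB v (by simp)

theorem mem_dirichletLaplacian_graph {x y : G.L2} :
    (x, y) ∈ G.dirichletLaplacian.graph ↔ ∃ c γ δ, G.IsStrongSolution univ x y c γ δ := by
  rw [dirichletLaplacian, laplacian_graph]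
  constructor
  · rintro ⟨f, f₁, f₂, hf, hB, hx, hy⟩
    refine ⟨0, fun e => f₁ e 0, fun e => f₁ e (G.len e), fun e => ?_, by simp, by simp⟩
    exact (edgeData_iff_exists_isSobolevTwo (G.len_pos e)).2
      ⟨f e, f₁ e, f₂ e, hf e, hx e, hy e, (hB e).1, (hB e).2, rfl, rfl⟩
  · rintro ⟨c, γ, δ, h, hc, -⟩
    choose f f₁ f₂ hf hx hy h1 h2 h3 h4 using
      fun e => (edgeData_iff_exists_isSobolevTwo (G.len_pos e)).1 (h e)
    exact ⟨f, f₁, f₂, hf, fun e => ⟨(h1 e).trans (hc _ trivial), (h2 e).trans (hc _ trivial)⟩,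
      hx, hy⟩

/-- The embedding of the form domain into `L²(G)`. -/
def formEmbedding (G : MetricGraph V E) (S : Set V) : G.formSpace S →L[ℂ] G.L2 :=
  WithLp.fstL 2 ℂ G.L2 G.L2 ∘L (G.formSpace S).subtypeL

/-- Split x = (x - V x') + V x': the first term is constant on each edge, so of finite rank, and the
second is compact because V is. -/
theorem isCompactOperator_formEmbedding (S : Set V) : IsCompactOperator (G.formEmbedding S) := by
  let J : G.formSpace S →L[ℂ] G.L2 :=
    (WithLp.fstL 2 ℂ G.L2 G.L2 - G.volterra ∘L WithLp.sndL 2 ℂ G.L2 G.L2) ∘L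
      (G.formSpace S).subtypeL
  have h1 : ∀ p, J p ∈ LinearMap.range G.edgeConst := by
    rintro ⟨p, hp⟩
    obtain ⟨c, -, hc⟩ := G.mem_formSpace.1 hp
    refine ⟨fun e => c (G.o e), ?_⟩
    ext1 e
    change _ = (p.fst - G.volterra p.snd) e
    rw [PiLp.sub_apply, volterra_apply, (hc e).1, edgeConst_apply]
    abel
  have h2 : IsCompactOperator J := by
    have h3 : IsCompactOperator (J.codRestrict _ h1) :=
      isCompactOperator_of_locallyCompactSpace_dom (J.codRestrict _ h1)
    exact h3.clm_comp (LinearMap.range G.edgeConst).subtypeL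
  have h4 : IsCompactOperator (G.volterra ∘L (WithLp.sndL 2 ℂ G.L2 G.L2 ∘L
      (G.formSpace S).subtypeL)) := G.isCompactOperator_volterra.comp_clm _
  have h5 : ⇑(G.formEmbedding S) = J + G.volterra ∘L (WithLp.sndL 2 ℂ G.L2 G.L2 ∘L
      (G.formSpace S).subtypeL) := by
    ext1 p
    exact (sub_add_cancel _ _).symm
  rw [h5]
  exact h2.add h4

/-- An operator given by the weak formulation has compact resolvent. -/
theorem exists_isCompactResolvent [Fintype V] {T : G.L2 →ₗ.[ℂ] G.L2} {S : Set V}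
    (hT : ∀ x y, (x, y) ∈ T.graph ↔ ∃ x', G.IsWeakSolution S x x' y) :
    ∃ R, IsCompactResolvent T R := by
  refine exists_isCompactResolvent_of_form (G.isClosed_formSpace S)
    (isCompactOperator_formEmbedding S) fun x y => (hT x y).trans (exists_congr fun x' => ?_)
  exact ⟨fun h => ⟨h.1, h.2⟩, fun h => ⟨h.1, h.2⟩⟩

end MetricGraph

/-! ### Algebra of quadratic forms in eigenvectors -/

section FormIdentities

variable {H : Type*} [NormedAddCommGroup H] [InnerProductSpace ℂ H]

theorem norm_sq_sum_of_inner_eq {ι : Type*} (s : Finset ι) {b b' : ι → H} {lam : ι → ℝ}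
    (hb : Orthonormal ℂ b) (h : ∀ i j, inner ℂ (b' i) (b' j) = lam j * inner ℂ (b i) (b j))
    (a : ι → ℂ) : ‖∑ i ∈ s, a i • b' i‖ ^ 2 = ∑ i ∈ s, lam i * ‖a i‖ ^ 2 := by
  classical
  have h1 : inner ℂ (∑ i ∈ s, a i • b' i) (∑ i ∈ s, a i • b' i) =
      ∑ i ∈ s, ((lam i * ‖a i‖ ^ 2 : ℝ) : ℂ) := by
    rw [sum_inner]
    refine Finset.sum_congr rfl fun i hi => ?_
    rw [inner_sum, Finset.sum_eq_single i]
    · rw [inner_smul_left, inner_smul_right, h, inner_self_eq_norm_sq_to_K, hb.1 i]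
      have := RCLike.conj_mul (a i)
      push_cast
      simp only [Complex.coe_algebraMap] at this
      linear_combination (lam i : ℂ) * this
    · intro j _ hj
      rw [inner_smul_left, inner_smul_right, h, hb.2 hj.symm]
      simp
    · exact fun h0 => absurd hi h0
  rw [← Complex.ofReal_sum] at h1
  rw [← @inner_self_eq_norm_sq ℂ, h1]
  exact Complex.ofReal_re _

/-- Bessel's inequality for a quadratic form. -/
theorem sum_mul_norm_sq_le_of_inner_eq {ι : Type*} (s : Finset ι) {b b' : ι → H} {lam : ι → ℝ}
    (hb : Orthonormal ℂ b) (h : ∀ i j, inner ℂ (b' i) (b' j) = lam j * inner ℂ (b i) (b j))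
    {x x' : H} (hx : ∀ j, inner ℂ x' (b' j) = lam j * inner ℂ x (b j)) :
    ∑ j ∈ s, lam j * ‖inner ℂ (b j) x‖ ^ 2 ≤ ‖x'‖ ^ 2 := by
  set p := ∑ j ∈ s, inner ℂ (b j) x • b' j with hp
  have h1 := norm_sq_sum_of_inner_eq s hb h fun j => inner ℂ (b j) x
  have h2 : inner ℂ x' p = ((∑ j ∈ s, lam j * ‖inner ℂ (b j) x‖ ^ 2 : ℝ) : ℂ) := by
    rw [hp, inner_sum]
    push_cast
    refine Finset.sum_congr rfl fun j _ => ?_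
    have := RCLike.conj_mul (inner ℂ (b j) x)
    rw [inner_conj_symm] at this
    simp only [Complex.coe_algebraMap] at this
    rw [inner_smul_right, hx]
    linear_combination (lam j : ℂ) * this
  -- Bessel by completing the square: ⟨x', p⟩ and ‖p‖² are the same sum, so ‖x' - p‖² ≥ 0 is the
  -- claim.
  have h3 := @norm_sub_sq ℂ _ _ _ _ x' p
  rw [h2, h1] at h3
  have h4 : RCLike.re ((∑ j ∈ s, lam j * ‖inner ℂ (b j) x‖ ^ 2 : ℝ) : ℂ) =
    ∑ j ∈ s, lam j * ‖inner ℂ (b j) x‖ ^ 2 := Complex.ofReal_re _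
  rw [h4] at h3
  nlinarith [sq_nonneg ‖x' - p‖]

/-- Adding a null vector of the form `‖·'‖² - μ ‖·‖²` does not change its value. -/
theorem norm_sq_sub_of_inner_eq {f f' u u' : H} {μ : ℝ} (c : ℂ)
    (hf : inner ℂ f' u' = μ * inner ℂ f u) (hu : inner ℂ u' u' = μ * inner ℂ u u) :
    ‖f' + c • u'‖ ^ 2 - μ * ‖f + c • u‖ ^ 2 = ‖f'‖ ^ 2 - μ * ‖f‖ ^ 2 := by
  have hu' : ‖u'‖ ^ 2 = μ * ‖u‖ ^ 2 := by
    rw [← @inner_self_eq_norm_sq ℂ, ← @inner_self_eq_norm_sq ℂ, hu]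
    exact Complex.re_ofReal_mul _ _
  have h1 : RCLike.re (inner ℂ f' (c • u')) = μ * RCLike.re (inner ℂ f (c • u)) := by
    rw [inner_smul_right, inner_smul_right, hf, ← mul_assoc, mul_comm c, mul_assoc]
    exact Complex.re_ofReal_mul _ _
  rw [@norm_add_sq ℂ, @norm_add_sq ℂ, h1, norm_smul, norm_smul, mul_pow, mul_pow, hu']
  ring

end FormIdentities

/-! ### Solutions of -x'' = ω² x on one edge -/

namespace EdgeData

variable {ℓ : ℝ} {x : EdgeL2 ℓ} {μ ω : ℝ} {γ δ : ℂ}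

theorem deriv_eq_zero (hℓ : 0 ≤ ℓ) (h : EdgeData x (((ω ^ 2 : ℝ) : ℂ) • x) 0 0 γ δ)
    (hω : Real.sin (ω * ℓ) ≠ 0) : γ = 0 ∧ δ = 0 := by
  -- Green's identity against exp(iνx). The choices ν = ω and ν = -ω give two equations for γ and δ,
  -- whose difference carries the factor sin(ωℓ).
  have key : ∀ ν : ℝ, ν ^ 2 = ω ^ 2 →
      starRingEnd ℂ γ = starRingEnd ℂ δ * Complex.exp (Complex.I * ν * ℓ) := by
    intro ν hν
    have h1 := h.green hℓ (EdgeData.exp hℓ ν)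
    rw [hν, inner_smul_left, inner_smul_right, Complex.conj_ofReal, sub_self] at h1
    simp only [map_zero] at h1
    linear_combination h1
  have h1 := key ω rfl
  have h2 := key (-ω) (by ring)
  have h3 : starRingEnd ℂ δ * (2 * Complex.I * Complex.sin (ω * ℓ)) = 0 := by
    have e1 : Complex.exp (Complex.I * ω * ℓ) - Complex.exp (Complex.I * (-ω : ℝ) * ℓ) =
        2 * Complex.I * Complex.sin (ω * ℓ) := by
      rw [Complex.sin]
      push_cast
      rw [show Complex.I * ω * ℓ = ω * ℓ * Complex.I by ring,
        show Complex.I * -ω * ℓ = -(ω * ℓ) * Complex.I by ring]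
      linear_combination (Complex.exp (ω * ℓ * Complex.I) - Complex.exp (-(ω * ℓ) * Complex.I)) *
        Complex.I_sq
    rw [← e1]
    linear_combination h2 - h1
  have h4 : Complex.sin (ω * ℓ) ≠ 0 := by exact_mod_cast hω
  have hδ : starRingEnd ℂ δ = 0 := by
    simpa [h4] using h3
  rw [hδ, zero_mul] at h1
  exact ⟨(map_eq_zero _).1 h1, (map_eq_zero _).1 hδ⟩

/-- A solution of `-x'' = ω² x` with vanishing Cauchy data vanishes. -/
theorem eq_zero (hℓ : 0 < ℓ) {β : ℂ} (h : EdgeData x (((ω ^ 2 : ℝ) : ℂ) • x) 0 β 0 δ) : x = 0 := by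
  have h1 : x = -(((ω ^ 2 : ℝ) : ℂ) • EdgeL2.volterra ℓ (EdgeL2.volterra ℓ x)) := by
    have := h.eq_fst
    simpa only [zero_smul, zero_add, zero_sub, map_neg, map_smul] using this
  have hI : ((ω ^ 2 : ℝ) : ℂ) = -(Complex.I * ω * (Complex.I * ω)) := by
    push_cast
    linear_combination (ω : ℂ) ^ 2 * Complex.I_sq
  -- The equation x + ω²V²x = 0 factors as (1 + iωV)(1 - iωV)x = 0, and each factor is injective
  -- because V is quasinilpotent.
  have h2 : x - (Complex.I * ω) • EdgeL2.volterra ℓ x =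
      (-(Complex.I * ω)) • EdgeL2.volterra ℓ (x - (Complex.I * ω) • EdgeL2.volterra ℓ x) := by
    rw [map_sub, map_smul, smul_sub, smul_smul, neg_mul, ← hI]
    nth_rw 1 [h1]
    rw [neg_smul]
    abel
  have h3 := EdgeL2.eq_zero_of_eq_smul_volterra hℓ h2
  exact EdgeL2.eq_zero_of_eq_smul_volterra hℓ (sub_eq_zero.1 h3)

theorem eq_zero_of_fst (hℓ : 0 < ℓ) {α β : ℂ} (h : EdgeData (0 : EdgeL2 ℓ) 0 α β γ δ) :
    α = 0 ∧ γ = 0 := by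
  have h1 := h.eq_fst
  rw [map_zero, sub_zero] at h1
  obtain ⟨h2, h3⟩ := EdgeL2.eq_zero_of_smul_one_add_volterra hℓ h1.symm
  refine ⟨h2, ?_⟩
  have h4 : inner ℂ (EdgeL2.one ℓ) (γ • EdgeL2.one ℓ) = 0 := by rw [h3, inner_zero_right]
  rw [inner_smul_right, EdgeL2.inner_one_one hℓ.le] at h4
  have : (ℓ : ℂ) ≠ 0 := by exact_mod_cast hℓ.ne'
  simpa [this] using h4

end EdgeData

namespace EdgeL2

/-- The cosine as an element of `L²(0, ℓ)`. -/
theorem exists_cos {ℓ : ℝ} (hℓ : 0 ≤ ℓ) {ω : ℝ} (hω : Real.sin (ω * ℓ) = 0) :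
    ∃ x : EdgeL2 ℓ, EdgeData x (((ω ^ 2 : ℝ) : ℂ) • x) 1 (Complex.exp (Complex.I * ω * ℓ)) 0 0 := by
  have hexp : Complex.exp (Complex.I * (-ω : ℝ) * ℓ) = Complex.exp (Complex.I * ω * ℓ) := by
    have h1 : Complex.sin (ω * ℓ) = 0 := by exact_mod_cast hω
    rw [show Complex.I * (-ω : ℝ) * ℓ = -(ω * ℓ) * Complex.I by push_cast; ring,
      show Complex.I * ω * ℓ = ω * ℓ * Complex.I by ring, Complex.exp_mul_I, Complex.exp_mul_I,
      Complex.sin_neg, Complex.cos_neg, h1, neg_zero]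
  have h := ((EdgeData.exp hℓ ω).add (EdgeData.exp hℓ (-ω))).smul (1 / 2)
  refine ⟨(1 / 2 : ℂ) • (exp ℓ ω + exp ℓ (-ω)), ?_⟩
  rw [neg_sq, hexp, ← smul_add, smul_comm] at h
  convert! h using 1
  · norm_num
  · ring
  · push_cast; ring
  · push_cast; ring

/-- The sine as an element of `L²(0, ℓ)`. -/
theorem exists_sin {ℓ : ℝ} (hℓ : 0 < ℓ) {ω : ℝ} (hω : Real.sin (ω * ℓ) = 0) (hω0 : ω ≠ 0) :
    ∃ x : EdgeL2 ℓ, x ≠ 0 ∧ ∃ γ δ, EdgeData x (((ω ^ 2 : ℝ) : ℂ) • x) 0 0 γ δ := by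
  have hexp : Complex.exp (Complex.I * (-ω : ℝ) * ℓ) = Complex.exp (Complex.I * ω * ℓ) := by
    have h1 : Complex.sin (ω * ℓ) = 0 := by exact_mod_cast hω
    rw [show Complex.I * (-ω : ℝ) * ℓ = -(ω * ℓ) * Complex.I by push_cast; ring,
      show Complex.I * ω * ℓ = ω * ℓ * Complex.I by ring, Complex.exp_mul_I, Complex.exp_mul_I,
      Complex.sin_neg, Complex.cos_neg, h1, neg_zero]
  have h := (EdgeData.exp hℓ.le ω).add ((EdgeData.exp hℓ.le (-ω)).smul (-1))
  rw [neg_sq, hexp, smul_comm, ← smul_add] at h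
  have h' : EdgeData (exp ℓ ω + (-1 : ℂ) • exp ℓ (-ω))
      (((ω ^ 2 : ℝ) : ℂ) • (exp ℓ ω + (-1 : ℂ) • exp ℓ (-ω))) 0 0 (2 * (Complex.I * ω))
      (Complex.I * ω * Complex.exp (Complex.I * ω * ℓ) +
        -1 * (Complex.I * (-ω : ℝ) * Complex.exp (Complex.I * ω * ℓ))) := by
    convert! h using 1
    · ring
    · ring
    · push_cast; ring
  refine ⟨_, fun h0 => ?_, _, _, h'⟩
  rw [h0, smul_zero] at h'
  have := (h'.eq_zero_of_fst hℓ).2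
  simp [hω0] at this

end EdgeL2

/-! ### Wronskians, waves and resonant eigenfunctions -/

namespace MetricGraph

variable {V E : Type*} [Fintype E] {G : MetricGraph V E}

theorem HasEdgeData.add {x y z w : G.L2} {c a : V → ℂ} {γ δ γ' δ' : E → ℂ}
    (h : G.HasEdgeData x y c γ δ) (h' : G.HasEdgeData z w a γ' δ') :
    G.HasEdgeData (x + z) (y + w) (c + a) (γ + γ') (δ + δ') := fun e => (h e).add (h' e)

theorem HasEdgeData.smul {x y : G.L2} {c : V → ℂ} {γ δ : E → ℂ} (r : ℂ)
    (h : G.HasEdgeData x y c γ δ) :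
    G.HasEdgeData (r • x) (r • y) (r • c) (r • γ) (r • δ) := fun e => (h e).smul r

/-- The Wronskian of two solutions is a flow, and hence zero on a tree. -/
theorem HasEdgeData.wronskian_eq_zero [Fintype V] (hG : G.IsTree) {μ : ℝ} {x z : G.L2}
    {c a : V → ℂ} {γ δ γ' δ' : E → ℂ} (h : G.HasEdgeData x ((μ : ℂ) • x) c γ δ)
    (h' : G.HasEdgeData z ((μ : ℂ) • z) a γ' δ')
    (hv : ∀ v, starRingEnd ℂ (c v) * G.flux γ' δ' v - starRingEnd ℂ (G.flux γ δ v) * a v = 0)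
    (e : E) : starRingEnd ℂ (c (G.o e)) * γ' e - starRingEnd ℂ (γ e) * a (G.o e) = 0 := by
  classical
  set w : E → ℂ := fun e => starRingEnd ℂ (c (G.o e)) * γ' e - starRingEnd ℂ (γ e) * a (G.o e)
  -- Both solutions have the same real μ, so Green's identity makes the Wronskian equal at the two
  -- ends of each edge.
  have hw : ∀ e, w e = starRingEnd ℂ (c (G.t e)) * δ' e - starRingEnd ℂ (δ e) * a (G.t e) := by
    intro e
    have h1 := (h e).green (G.len_pos e).le (h' e)
    rw [PiLp.smul_apply, PiLp.smul_apply, inner_smul_left, inner_smul_right, Complex.conj_ofReal,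
      sub_self] at h1
    simp only [w]
    linear_combination -h1
  have h0 : w = 0 := hG.eq_zero_of_flux_eq_zero fun v => by
    rw [← hv v, flux, flux, flux]
    have e1 : ∑ e with G.t e = v, w e = ∑ e with G.t e = v,
        (starRingEnd ℂ (c v) * δ' e - starRingEnd ℂ (δ e) * a v) :=
      Finset.sum_congr rfl fun e he => by rw [hw, (Finset.mem_filter.1 he).2]
    have e2 : ∑ e with G.o e = v, w e = ∑ e with G.o e = v,
        (starRingEnd ℂ (c v) * γ' e - starRingEnd ℂ (γ e) * a v) :=
      Finset.sum_congr rfl fun e he => by simp only [w]; rw [(Finset.mem_filter.1 he).2]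
    rw [e1, e2]
    simp only [map_sub, map_sum, Finset.sum_sub_distrib, ← Finset.mul_sum, ← Finset.sum_mul]
    ring
  exact congrFun h0 e

/-- On a tree there is a solution of `-u'' = ω² u` of the form `exp (i ω d)`. -/
theorem IsTree.exists_wave [Fintype V] (hG : G.IsTree) (ω : ℝ) :
    ∃ (u : G.L2) (c : V → ℂ), (∀ v, starRingEnd ℂ (c v) * c v = 1) ∧
      G.HasEdgeData u (((ω ^ 2 : ℝ) : ℂ) • u) c (fun e => Complex.I * ω * c (G.o e))
        (fun e => Complex.I * ω * c (G.t e)) := by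
  obtain ⟨d, hd⟩ := hG.exists_potential
  refine ⟨WithLp.toLp 2 fun e =>
    Complex.exp (Complex.I * ω * d (G.o e)) • EdgeL2.exp (G.len e) ω,
    fun v => Complex.exp (Complex.I * ω * d v), fun v => ?_, fun e => ?_⟩
  · rw [← Complex.exp_conj, ← Complex.exp_add]
    simp
  · have h := (EdgeData.exp (G.len_pos e).le ω).smul (Complex.exp (Complex.I * ω * d (G.o e)))
    have h2 : Complex.exp (Complex.I * ω * d (G.t e)) = Complex.exp (Complex.I * ω * d (G.o e)) *
        Complex.exp (Complex.I * ω * G.len e) := by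
      rw [hd, ← Complex.exp_add]
      push_cast
      ring_nf
    convert! h using 1
    · rw [PiLp.smul_apply, smul_comm]
    · ring
    · ring
    · beta_reduce
      rw [h2]; ring

/-- If `ω` is resonant on all edges, there is a standard eigenfunction without zeros at the
vertices. -/
theorem IsTree.exists_standard_eigenfunction [Fintype V] (hG : G.IsTree) {ω : ℝ}
    (hω : ∀ e, Real.sin (ω * G.len e) = 0) :
    ∃ (u : G.L2) (c : V → ℂ), (∀ v, c v ≠ 0) ∧
      G.IsStrongSolution ∅ u (((ω ^ 2 : ℝ) : ℂ) • u) c 0 0 := by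
  obtain ⟨d, hd⟩ := hG.exists_potential
  choose s hs using fun e => EdgeL2.exists_cos (G.len_pos e).le (hω e)
  refine ⟨WithLp.toLp 2 fun e => Complex.exp (Complex.I * ω * d (G.o e)) • s e,
    fun v => Complex.exp (Complex.I * ω * d v), fun v => Complex.exp_ne_zero _,
    fun e => ?_, by simp, fun v _ => by simp [flux]⟩
  -- At a resonance exp(iωL) = cos(ωL) = ±1, so the cosines scaled by exp(iωd) fit together at the
  -- vertices; their derivatives vanish at all ends.
  have h := (hs e).smul (Complex.exp (Complex.I * ω * d (G.o e)))
  have h2 : Complex.exp (Complex.I * ω * d (G.t e)) = Complex.exp (Complex.I * ω * d (G.o e)) *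
      Complex.exp (Complex.I * ω * G.len e) := by
    rw [hd, ← Complex.exp_add]
    push_cast
    ring_nf
  convert! h using 1
  · rw [PiLp.smul_apply, smul_comm]
  · ring
  · simp
  · simp

theorem single_mem_kerSub_dirichlet [DecidableEq E] {ω : ℝ} {e : E} {s : EdgeL2 (G.len e)}
    {γ δ : ℂ} (hs : EdgeData s (((ω ^ 2 : ℝ) : ℂ) • s) 0 0 γ δ) :
    (PiLp.single 2 e s : G.L2) ∈ G.dirichletLaplacian.kerSub ((ω ^ 2 : ℝ) : ℂ) := by
  rw [LinearPMap.mem_kerSub, mem_dirichletLaplacian_graph]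
  refine ⟨0, Pi.single e γ, Pi.single e δ, fun e' => ?_, by simp, by simp⟩
  by_cases he : e' = e
  · subst he
    simpa using hs
  · simpa [he] using EdgeData.zero (G.len e')

/-- The multiplicity of a resonant Dirichlet eigenvalue. -/
theorem card_le_finrank_kerSub_dirichlet {ω : ℝ} (hω0 : ω ≠ 0)
    (hω : ∀ e, Real.sin (ω * G.len e) = 0)
    [FiniteDimensional ℂ (G.dirichletLaplacian.kerSub ((ω ^ 2 : ℝ) : ℂ))] :
    Fintype.card E ≤ Module.finrank ℂ (G.dirichletLaplacian.kerSub ((ω ^ 2 : ℝ) : ℂ)) := by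
  classical
  choose s hs0 γ δ hs using fun e => EdgeL2.exists_sin (G.len_pos e) (hω e) hω0
  let v : E → G.dirichletLaplacian.kerSub ((ω ^ 2 : ℝ) : ℂ) := fun e =>
    ⟨PiLp.single 2 e (s e), single_mem_kerSub_dirichlet (hs e)⟩
  have hv : LinearIndependent ℂ v := by
    rw [Fintype.linearIndependent_iff]
    intro g hg e
    have h1 := congrArg (fun x : G.dirichletLaplacian.kerSub ((ω ^ 2 : ℝ) : ℂ) => (x : G.L2) e) hg
    simp only [Submodule.coe_sum, Submodule.coe_smul, WithLp.ofLp_sum, Finset.sum_apply,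
      PiLp.smul_apply, v, Submodule.coe_zero, PiLp.zero_apply] at h1
    rw [Finset.sum_eq_single e (fun e' _ he => by simp [he.symm]) (by simp),
      PiLp.single_eq_same] at h1
    exact (smul_eq_zero.1 h1).resolve_right (hs0 e)
  exact hv.fintype_card_le_finrank

end MetricGraph

/-! ### Eigenbases on G and comparison of the two spectra -/

namespace MetricGraph

variable {V E : Type*} [Fintype E] {G : MetricGraph V E}

theorem exists_isCompactResolvent_standard [Fintype V] (G : MetricGraph V E) :
    ∃ R, IsCompactResolvent G.standardLaplacian R :=
  exists_isCompactResolvent (S := ∅) fun _ _ =>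
    mem_standardLaplacian_graph.trans exists_isWeakSolution_iff.symm

theorem exists_isCompactResolvent_dirichlet [Fintype V] (G : MetricGraph V E) :
    ∃ R, IsCompactResolvent G.dirichletLaplacian R :=
  exists_isCompactResolvent (S := univ) fun _ _ =>
    mem_dirichletLaplacian_graph.trans exists_isWeakSolution_iff.symm

/-- The sines on a single edge give the resolvent infinitely many eigenvalues. -/
theorem not_finiteDimensional_L2 [Fintype V] [Nonempty E] (G : MetricGraph V E) :
    ¬ FiniteDimensional ℂ G.L2 := by
  classical
  intro hfin
  obtain ⟨R, hR⟩ := G.exists_isCompactResolvent_dirichlet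
  have e : E := Classical.arbitrary E
  have hL := G.len_pos e
  let ω : ℕ → ℝ := fun n => (n + 1) * Real.pi / G.len e
  have hω : ∀ n, 0 < ω n := fun n => by positivity
  have hωinj : Function.Injective ω := fun m n h => by
    have h1 : ((m : ℝ) + 1) * Real.pi = (n + 1) * Real.pi := (div_left_inj' hL.ne').1 h
    have h2 := mul_right_cancel₀ Real.pi_ne_zero h1
    exact_mod_cast add_right_cancel h2
  have hfin' := Module.End.finite_hasEigenvalue (R : G.L2 →ₗ[ℂ] G.L2)
  refine Set.infinite_of_injective_forall_mem (f := fun n => (1 + ((ω n ^ 2 : ℝ) : ℂ))⁻¹) ?_ ?_ hfin'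
  · intro m n h
    have h1 : ω m ^ 2 = ω n ^ 2 := by
      have := add_left_cancel (inv_injective h)
      exact_mod_cast this
    exact hωinj ((sq_eq_sq₀ (hω m).le (hω n).le).1 h1)
  · intro n
    have hsin : Real.sin (ω n * G.len e) = 0 := by
      rw [div_mul_cancel₀ _ hL.ne']
      exact_mod_cast Real.sin_nat_mul_pi (n + 1)
    obtain ⟨s, hs0, γ, δ, hs⟩ := EdgeL2.exists_sin hL hsin (hω n).ne'
    have h1 := single_mem_kerSub_dirichlet hs
    have hne : ((ω n ^ 2 : ℝ) : ℂ) ≠ -1 := fun h => by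
      have h2 : ω n ^ 2 = -1 := by exact_mod_cast h
      nlinarith [sq_nonneg (ω n)]
    rw [hR.kerSub_eq_eigenspace hne] at h1
    refine Module.End.hasEigenvalue_of_hasEigenvector ⟨h1, ?_⟩
    rwa [Ne, PiLp.single_eq_zero_iff]

/-- An orthonormal basis of `L²(G)` consisting of weak eigenfunctions `b j`, with derivatives `b' j`
and vertex values `c j`. -/
structure IsEigenbasis (G : MetricGraph V E) (S : Set V) (lam : ℕ → ℝ) (b : HilbertBasis ℕ ℂ G.L2)
    (b' : ℕ → G.L2) (c : ℕ → V → ℂ) : Prop where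
  hasGradient : ∀ j, G.HasGradient (c j) (b j) (b' j)
  dirichlet : ∀ j, ∀ v ∈ S, c j v = 0
  inner_eq : ∀ j a z z', (∀ v ∈ S, a v = 0) → G.HasGradient a z z' →
    inner ℂ z' (b' j) = lam j * inner ℂ z (b j)

theorem exists_isEigenbasis [Fintype V] {T : G.L2 →ₗ.[ℂ] G.L2} {S : Set V} {lam : ℕ → ℝ}
    {b : HilbertBasis ℕ ℂ G.L2}
    (hT : ∀ x y, (x, y) ∈ T.graph ↔ ∃ c γ δ, G.IsStrongSolution S x y c γ δ)
    (hb : ∀ j, (b j, (lam j : ℂ) • b j) ∈ T.graph) :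
    ∃ b' c, G.IsEigenbasis S lam b b' c := by
  choose c γ δ h using fun j => (hT _ _).1 (hb j)
  refine ⟨fun j => gradient ((lam j : ℂ) • b j) (γ j), c,
    fun j => (h j).hasEdgeData.hasGradient, fun j => (h j).dirichlet, fun j a z z' ha hz => ?_⟩
  rw [(h j).isWeakSolution.inner_eq z z' (G.toLp_mem_formSpace.2 ⟨a, ha, hz⟩), inner_smul_right]

namespace IsEigenbasis

variable {S : Set V} {lam : ℕ → ℝ} {b : HilbertBasis ℕ ℂ G.L2} {b' : ℕ → G.L2} {c : ℕ → V → ℂ}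

theorem inner_deriv (h : G.IsEigenbasis S lam b b' c) (i j : ℕ) :
    inner ℂ (b' i) (b' j) = lam j * inner ℂ (b i) (b j) :=
  h.inner_eq j _ _ _ (h.dirichlet i) (h.hasGradient i)

theorem sub_mul_norm_sq_le (h : G.IsEigenbasis S lam b b' c) {μ : ℝ} {x x' : G.L2} {a : V → ℂ}
    (ha : ∀ v ∈ S, a v = 0) (hx : G.HasGradient a x x')
    (hlow : ∀ j, lam j < μ → inner ℂ (b j) x = 0) (k : ℕ) :
    (lam k - μ) * ‖inner ℂ (b k) x‖ ^ 2 ≤ ‖x'‖ ^ 2 - μ * ‖x‖ ^ 2 :=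
  b.sub_mul_norm_sq_le (fun s => sum_mul_norm_sq_le_of_inner_eq s b.orthonormal h.inner_deriv
    fun j => h.inner_eq j _ _ _ ha hx) hlow k

theorem norm_sq_sub_eq (h : G.IsEigenbasis S lam b b' c) {n : ℕ} (a : Fin n → ℂ) (μ : ℝ) :
    ‖∑ i, a i • b' i‖ ^ 2 - μ * ‖∑ i, a i • b i‖ ^ 2 =
      ∑ i : Fin n, (lam i - μ) * ‖a i‖ ^ 2 := by
  have hb : Orthonormal ℂ fun i : Fin n => b i := b.orthonormal.comp _ Fin.val_injective
  have h1 := norm_sq_sum_of_inner_eq Finset.univ (b' := fun i : Fin n => b' i)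
    (lam := fun i : Fin n => lam i) hb (fun i j => h.inner_deriv i j) a
  have h2 := norm_sq_sum_of_inner_eq Finset.univ (b' := fun i : Fin n => b i)
    (lam := fun _ : Fin n => 1) hb (fun i j => by simp) a
  rw [h1, h2, Finset.mul_sum, ← Finset.sum_sub_distrib]
  exact Finset.sum_congr rfl fun i _ => by ring

theorem hasGradient_sum (h : G.IsEigenbasis S lam b b' c) {n : ℕ} (a : Fin n → ℂ) :
    G.HasGradient (∑ i, a i • c i) (∑ i, a i • b i) (∑ i, a i • b' i) :=
  HasGradient.sum _ fun i _ => (h.hasGradient i).smul (a i)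

/-- Dirichlet eigenvalues are positive. -/
theorem pos [Nonempty E] (h : G.IsEigenbasis univ lam b b' c) (j : ℕ) : 0 < lam j := by
  have h1 := h.inner_deriv j j
  have hb : ‖b j‖ = 1 := b.orthonormal.1 j
  have h2 : ‖b' j‖ ^ 2 = lam j := by
    have h3 := congrArg Complex.re h1
    rw [Complex.re_ofReal_mul] at h3
    have h4 : (inner ℂ (b' j) (b' j)).re = ‖b' j‖ ^ 2 := inner_self_eq_norm_sq (𝕜 := ℂ) _
    have h5 : (inner ℂ (b j) (b j)).re = ‖b j‖ ^ 2 := inner_self_eq_norm_sq (𝕜 := ℂ) _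
    rw [h4, h5, hb] at h3
    linarith
  rw [← h2]
  have h6 : b' j ≠ 0 := fun h0 => by
    have h7 : b j = 0 := by
      ext1 e
      rw [(h.hasGradient j e).1, h0, h.dirichlet j _ trivial]
      simp
    rw [h7, norm_zero] at hb
    exact zero_ne_one hb
  positivity

end IsEigenbasis

/-- If a standard eigenvalue `lam (j + 1)` is at least `μ = lamD j`, then some combination of
Dirichlet eigenfunctions and a wave is a standard eigenfunction. -/
theorem exists_standard_eigenfunction_of_le [Fintype V] [Nonempty E] {lam lamD : ℕ → ℝ}
    {b bD : HilbertBasis ℕ ℂ G.L2} {b' bD' : ℕ → G.L2} {c cD : ℕ → V → ℂ}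
    (h : G.IsEigenbasis ∅ lam b b' c) (hD : G.IsEigenbasis univ lamD bD bD' cD)
    (hmono : Monotone lam) (hmonoD : Monotone lamD) {j : ℕ} (hj : lamD j ≤ lam (j + 1))
    {u : G.L2} {a : V → ℂ} {γ δ : E → ℂ} (ha : ∀ v, a v ≠ 0)
    (hu : G.HasEdgeData u ((lamD j : ℂ) • u) a γ δ)
    (hflux : ∑ v, starRingEnd ℂ (a v) * G.flux γ δ v = 0) :
    ∃ (f f' : G.L2) (r : ℂ), G.HasGradient 0 f f' ∧ f + r • u ≠ 0 ∧
      ∀ k, inner ℂ (b k) (f + r • u) = 0 ∨ lam k = lamD j ∧ ¬ lamD j < lam (j + 1) := by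
  set μ := lamD j with hμ
  let Φ : (Fin (j + 1) → ℂ) × ℂ →ₗ[ℂ] G.L2 :=
    (Fintype.linearCombination ℂ fun i : Fin (j + 1) => bD i).coprod
      (LinearMap.toSpanSingleton ℂ G.L2 u)
  have hΦ : ∀ p, Φ p = ∑ i, p.1 i • bD i + p.2 • u := fun p => by
    simp [Φ, Fintype.linearCombination_apply]
  let Ψ : (Fin (j + 1) → ℂ) × ℂ →ₗ[ℂ] (Fin (j + 1) → ℂ) :=
    LinearMap.pi fun i => (innerSL ℂ (b i)).toLinearMap ∘ₗ Φ
  -- There are j + 2 coefficients, for `bD 0`, …, `bD j` and the wave, against j + 1 conditions of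
  -- orthogonality to `b 0`, …, `b j`.
  have hker : LinearMap.ker Ψ ≠ ⊥ := LinearMap.ker_ne_bot_of_finrank_lt (by simp)
  obtain ⟨p, hp, hp0⟩ := Submodule.exists_mem_ne_zero_of_ne_bot hker
  have horth : ∀ i, i ≤ j → inner ℂ (b i) (Φ p) = 0 := fun i hi =>
    congrFun (LinearMap.mem_ker.1 hp) ⟨i, Nat.lt_succ_of_le hi⟩
  rw [hΦ] at horth
  set f := ∑ i, p.1 i • bD i with hf
  set f' := ∑ i, p.1 i • bD' i with hf'
  have hcD : ∑ i, p.1 i • cD i = 0 := Finset.sum_eq_zero fun i _ => by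
    have : cD i = 0 := funext fun v => hD.dirichlet i v trivial
    rw [this, smul_zero]
  have hgf : G.HasGradient 0 f f' := by
    have := hD.hasGradient_sum p.1
    rwa [hcD] at this
  have hgu := hu.hasGradient
  set u' := gradient ((μ : ℂ) • u) γ with hu'
  have hgx : G.HasGradient (p.2 • a) (f + p.2 • u) (f' + p.2 • u') := by
    have := hgf.add (hgu.smul p.2)
    rwa [zero_add] at this
  have huu : inner ℂ u' u' = μ * inner ℂ u u := by
    have := hu.inner_gradient_sub hgu
    rwa [hflux, inner_smul_right, sub_eq_zero] at this
  have hfu : inner ℂ f' u' = μ * inner ℂ f u := by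
    have := hu.inner_gradient_sub hgf
    simp only [Pi.zero_apply, map_zero, zero_mul, Finset.sum_const_zero, inner_smul_right,
      sub_eq_zero] at this
    exact this
  -- The wave is null for the form shifted by μ, so only the Dirichlet part counts, with
  -- coefficients `lamD i - μ ≤ 0`.
  have hval : ‖f' + p.2 • u'‖ ^ 2 - μ * ‖f + p.2 • u‖ ^ 2 ≤ 0 := by
    rw [norm_sq_sub_of_inner_eq p.2 hfu huu, hD.norm_sq_sub_eq]
    refine Finset.sum_nonpos fun i _ => mul_nonpos_of_nonpos_of_nonneg ?_ (sq_nonneg _)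
    have := hmonoD (Nat.lt_succ_iff.1 i.2)
    linarith
  have hlow : ∀ k, lam k < lam (j + 1) → inner ℂ (b k) (f + p.2 • u) = 0 := fun k hk => by
    refine horth k (Nat.lt_succ_iff.1 ?_)
    by_contra h0
    exact absurd (hmono (not_lt.1 h0)) (not_le.2 hk)
  have hcoef := h.sub_mul_norm_sq_le (μ := μ) (fun _ h0 => absurd h0 (notMem_empty _)) hgx
    fun k hk => hlow k (hk.trans_le hj)
  refine ⟨f, f', p.2, hgf, fun h0 => hp0 ?_, fun k => ?_⟩
  · rw [h0] at hgx
    have h1 := hgx.eq_zero.1 (Classical.arbitrary E)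
    have h2 : p.2 = 0 := by simpa [ha] using h1
    have h3 : p.1 = 0 := by
      rw [h2, zero_smul, add_zero] at h0
      have hb : Orthonormal ℂ fun i : Fin (j + 1) => bD i :=
        bD.orthonormal.comp _ Fin.val_injective
      exact funext (Fintype.linearIndependent_iff.1 hb.linearIndependent p.1 h0)
    exact Prod.ext h3 h2
  -- A nonzero coefficient forces lam (j + 1) ≤ lam k ≤ μ ≤ lam (j + 1), hence equality throughout.
  · by_cases h0 : inner ℂ (b k) (f + p.2 • u) = 0
    · exact Or.inl h0
    · have h1 : lam (j + 1) ≤ lam k := not_lt.1 fun hk => h0 (hlow k hk)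
      have h2 : 0 < ‖inner ℂ (b k) (f + p.2 • u)‖ ^ 2 := by positivity
      have h3 : lam k - μ ≤ 0 := by
        by_contra h4
        have := mul_pos (not_le.1 h4) h2
        linarith [hcoef k]
      exact Or.inr ⟨by linarith, by linarith⟩

/-- A standard eigenfunction on a tree which differs from a multiple of a wave by a function
vanishing at the vertices is zero, provided that some edge is not resonant. -/
theorem IsTree.eq_zero_of_isStrongSolution [Fintype V] (hG : G.IsTree) {ω : ℝ} {u : G.L2}
    {a : V → ℂ}
    (ha : ∀ v, starRingEnd ℂ (a v) * a v = 1)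
    (hu : G.HasEdgeData u (((ω ^ 2 : ℝ) : ℂ) • u) a (fun e => Complex.I * ω * a (G.o e))
      (fun e => Complex.I * ω * a (G.t e))) {f f' : G.L2} {r : ℂ} (hf : G.HasGradient 0 f f')
    {c : V → ℂ} {γ δ : E → ℂ}
    (hx : G.IsStrongSolution ∅ (f + r • u) (((ω ^ 2 : ℝ) : ℂ) • (f + r • u)) c γ δ)
    {e : E} (he : Real.sin (ω * G.len e) ≠ 0) : f + r • u = 0 := by
  have hω : (ω : ℂ) ≠ 0 := by
    intro h0
    rw [Complex.ofReal_eq_zero.1 h0] at he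
    simp at he
  have ha0 : ∀ v, a v ≠ 0 := fun v h0 => by simpa [h0] using ha v
  -- Subtracting r u from the eigenfunction shows that f itself solves the equation on the edges;
  -- its vertex values are zero by uniqueness of the data.
  have hfd := hx.hasEdgeData.add (hu.smul (-r))
  have hfe : f + r • u + (-r) • u = f := by rw [neg_smul]; abel
  have hfe' : ((ω ^ 2 : ℝ) : ℂ) • (f + r • u) + (-r) • ((ω ^ 2 : ℝ) : ℂ) • u =
      ((ω ^ 2 : ℝ) : ℂ) • f := by
    rw [smul_comm (-r), ← smul_add, hfe]
  rw [hfe, hfe'] at hfd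
  have hzero := (hfd.hasGradient.add (hf.smul (-1)))
  rw [neg_one_smul, neg_one_smul, add_neg_cancel] at hzero
  have ho : ∀ e, c (G.o e) + -r * a (G.o e) = 0 := fun e => by simpa using hzero.eq_zero.1 e
  have ht : ∀ e, c (G.t e) + -r * a (G.t e) = 0 := fun e => by
    have h1 := (hzero e).2
    rw [hzero.eq_zero.2] at h1
    simp only [Pi.add_apply, Pi.smul_apply, PiLp.zero_apply, smul_eq_mul, neg_zero, Pi.zero_apply,
      inner_zero_right, add_zero] at h1
    rw [h1]
    exact ho e
  have hfE : ∀ e, EdgeData (f e) (((ω ^ 2 : ℝ) : ℂ) • f e) 0 0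
      (γ e + -r * (Complex.I * ω * a (G.o e))) (δ e + -r * (Complex.I * ω * a (G.t e))) := by
    intro e
    have := hfd e
    simp only [Pi.add_apply, Pi.smul_apply, smul_eq_mul, ho, ht] at this
    exact this
  have hkir : ∀ v, G.flux γ δ v = 0 := fun v => hx.kirchhoff v (notMem_empty v)
  have hr : r = 0 := by
    -- On the nonresonant edge f has zero end derivatives, so the eigenfunction has the Cauchy data
    -- of r u there, and its Wronskian with itself is 2iω|r|².
    have h1 := hx.hasEdgeData.wronskian_eq_zero hG hx.hasEdgeData (fun v => by simp [hkir]) e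
    have h2 := ((hfE e).deriv_eq_zero (G.len_pos e).le he).1
    have h3 : c (G.o e) = r * a (G.o e) := by linear_combination ho e
    have h4 : γ e = r * (Complex.I * ω * a (G.o e)) := by linear_combination h2
    rw [h3, h4] at h1
    simp only [map_mul, Complex.conj_I, Complex.conj_ofReal] at h1
    have h5 : starRingEnd ℂ r * r * (2 * Complex.I * ω) = 0 := by
      linear_combination h1 - (starRingEnd ℂ r * r * (2 * Complex.I * ω)) * (ha (G.o e))
    simpa [hω] using h5
  subst hr
  simp only [neg_zero, zero_mul, add_zero] at hfE
  have hf0 : G.HasEdgeData f (((ω ^ 2 : ℝ) : ℂ) • f) 0 γ δ := hfE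
  have hγ : ∀ e, γ e = 0 := fun e => by
    -- Now f satisfies both the Dirichlet and the Kirchhoff conditions. Its Wronskian with the
    -- nonvanishing wave reduces to the derivative of f, which must vanish on every edge.
    have h1 := hf0.wronskian_eq_zero hG hu (fun v => by simp [hkir]) e
    simpa [ha0] using h1
  rw [zero_smul, add_zero]
  ext1 e
  have h1 := hfE e
  rw [hγ] at h1
  exact h1.eq_zero (G.len_pos e)

/-! ### Commensurable lengths and failure of strictness -/

/-- Lengths of resonant edges are commensurable. -/
theorem not_linearIndependent_of_sin_eq_zero {ω ℓ ℓ' : ℝ} (hω : ω ≠ 0) (hℓ : 0 < ℓ)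
    (h : Real.sin (ω * ℓ) = 0) (h' : Real.sin (ω * ℓ') = 0) :
    ¬ LinearIndependent ℚ ![ℓ, ℓ'] := by
  rw [Real.sin_eq_zero_iff] at h h'
  obtain ⟨n, hn⟩ := h
  obtain ⟨m, hm⟩ := h'
  rw [LinearIndependent.pair_iff]
  intro hlin
  have h1 := hlin m (-n) (by
    rw [Rat.smul_def, Rat.smul_def]
    push_cast
    apply mul_left_cancel₀ hω
    linear_combination (m : ℝ) * (-hn) - n * (-hm))
  have hn0 : n = 0 := by simpa using h1.2
  rw [hn0] at hn
  simp [hω, hℓ.ne'] at hn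

/-- If all edge lengths are commensurable, they are resonant for a common frequency. -/
theorem exists_resonance [Nonempty E] (G : MetricGraph V E)
    (h : ∀ e e' : E, ¬ LinearIndependent ℚ ![G.len e, G.len e']) :
    ∃ ω : ℝ, ω ≠ 0 ∧ ∀ e, Real.sin (ω * G.len e) = 0 := by
  classical
  have e₀ : E := Classical.arbitrary E
  have hq : ∀ e, ∃ q : ℚ, G.len e = q * G.len e₀ := fun e => by
    have h1 := h e₀ e
    rw [LinearIndependent.pair_iff' (G.len_pos e₀).ne'] at h1
    push Not at h1
    obtain ⟨q, hq⟩ := h1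
    exact ⟨q, by rw [← hq, Rat.smul_def]⟩
  choose q hq using hq
  -- A common denominator of the ratios to the reference edge: with ω = πN / L(e₀) every ωL(e) is an
  -- integer multiple of π.
  let N : ℕ := ∏ e, (q e).den
  have hN : 0 < N := Finset.prod_pos fun e _ => (q e).den_pos
  have hL := G.len_pos e₀
  have hNR : (0 : ℝ) < N := by exact_mod_cast hN
  refine ⟨Real.pi * N / G.len e₀, by positivity, fun e => ?_⟩
  obtain ⟨k, hk⟩ : (q e).den ∣ N := Finset.dvd_prod_of_mem _ (Finset.mem_univ e)
  rw [Real.sin_eq_zero_iff]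
  refine ⟨(q e).num * k, ?_⟩
  have h1 : (q e : ℝ) * (q e).den = (q e).num := by exact_mod_cast (q e).mul_den_eq_num
  rw [hk, hq e]
  push_cast
  rw [← h1]
  field_simp

/-- In a monotone sequence, a value attained `m` times is attained at `m` consecutive indices. -/
theorem exists_consecutive {lam : ℕ → ℝ} (hmono : Monotone lam) {μ : ℝ} {m : ℕ} (hm : 0 < m)
    (hcard : (m : ℕ∞) ≤ {j | lam j = μ}.encard) :
    ∃ p, lam p = μ ∧ (∀ k, lam k < μ → k < p) ∧ lam (p + (m - 1)) ≤ μ := by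
  classical
  have hne : ∃ k, lam k = μ := by
    by_contra! h0
    have : {j | lam j = μ} = ∅ := Set.eq_empty_of_forall_notMem h0
    rw [this, Set.encard_empty] at hcard
    have : m = 0 := by simpa using hcard
    omega
  refine ⟨Nat.find hne, Nat.find_spec hne, fun k hk => ?_, ?_⟩
  · by_contra h0
    have := hmono (not_lt.1 h0)
    rw [Nat.find_spec hne] at this
    linarith
  · by_contra! h0
    have hsub : {j | lam j = μ} ⊆ (Finset.Ico (Nat.find hne) (Nat.find hne + (m - 1)) : Set ℕ) := by
      intro k hk
      rw [Finset.coe_Ico]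
      refine ⟨Nat.find_min' hne hk, ?_⟩
      by_contra h1
      have := hmono (not_lt.1 h1)
      rw [show lam k = μ from hk] at this
      linarith
    have h1 := hcard.trans (Set.encard_le_encard hsub)
    rw [Set.encard_coe_eq_coe_finsetCard, Nat.card_Ico] at h1
    have h2 : m ≤ Nat.find hne + (m - 1) - Nat.find hne := by exact_mod_cast h1
    omega

/-- At a common resonance of all edges the strict inequality fails. -/
theorem not_lt_of_resonance [Fintype V] [Nonempty E] (hG : G.IsTree) {lam lamD : ℕ → ℝ}
    {b bD : HilbertBasis ℕ ℂ G.L2} {b' bD' : ℕ → G.L2} {c cD : ℕ → V → ℂ}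
    (h : G.IsEigenbasis ∅ lam b b' c) (hD : G.IsEigenbasis univ lamD bD bD' cD)
    (hmono : Monotone lam) {ω : ℝ} (hω : ∀ e, Real.sin (ω * G.len e) = 0) {p : ℕ}
    (hp : lamD p = ω ^ 2) (hp' : ∀ k, lamD k < ω ^ 2 → k < p) :
    ω ^ 2 ≤ lam (p + Fintype.card E) := by
  by_contra! hlt
  obtain ⟨u, a, ha, hu⟩ := hG.exists_standard_eigenfunction hω
  set μ := ω ^ 2 with hμ
  let n := p + Fintype.card E + 1
  let Φ : (Fin n → ℂ) × ℂ →ₗ[ℂ] G.L2 :=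
    (Fintype.linearCombination ℂ fun i : Fin n => b i).coprod
      (LinearMap.toSpanSingleton ℂ G.L2 u)
  have hΦ : ∀ w, Φ w = ∑ i, w.1 i • b i + w.2 • u := fun w => by
    simp [Φ, Fintype.linearCombination_apply]
  let Φc : (Fin n → ℂ) × ℂ →ₗ[ℂ] (V → ℂ) :=
    (Fintype.linearCombination ℂ fun i : Fin n => c i).coprod
      (LinearMap.toSpanSingleton ℂ (V → ℂ) a)
  have hΦc : ∀ w, Φc w = ∑ i, w.1 i • c i + w.2 • a := fun w => by
    simp [Φc, Fintype.linearCombination_apply]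
  let Ψ : (Fin n → ℂ) × ℂ →ₗ[ℂ] (V → ℂ) × (Fin p → ℂ) :=
    Φc.prod (LinearMap.pi fun i : Fin p => (innerSL ℂ (bD i)).toLinearMap ∘ₗ Φ)
  -- The unknowns number p + |E| + 2. The conditions, |V| = |E| + 1 vertex values and p
  -- orthogonality relations, are one fewer; the extra function u makes the difference.
  have hker : LinearMap.ker Ψ ≠ ⊥ := LinearMap.ker_ne_bot_of_finrank_lt (by
    have := hG.card_eq
    simp only [Module.finrank_prod, Module.finrank_fintype_fun_eq_card, Fintype.card_fin,
      Module.finrank_self]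
    omega)
  obtain ⟨w, hw, hw0⟩ := Submodule.exists_mem_ne_zero_of_ne_bot hker
  have hw1 : Φc w = 0 := congrArg Prod.fst (LinearMap.mem_ker.1 hw)
  have hw2 : ∀ k, lamD k < μ → inner ℂ (bD k) (Φ w) = 0 := fun k hk =>
    congrFun (congrArg Prod.snd (LinearMap.mem_ker.1 hw)) ⟨k, hp' k hk⟩
  rw [hΦc] at hw1
  rw [hΦ] at hw2
  have hgu := hu.hasEdgeData.hasGradient
  set u' := gradient ((μ : ℂ) • u) 0 with hu'
  have hgx : G.HasGradient 0 (∑ i, w.1 i • b i + w.2 • u) (∑ i, w.1 i • b' i + w.2 • u') := by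
    have := (h.hasGradient_sum w.1).add (hgu.smul w.2)
    rwa [hw1] at this
  have hweak : ∀ {d : V → ℂ} {z z' : G.L2}, G.HasGradient d z z' →
      inner ℂ z' u' = μ * inner ℂ z u := fun hz => by
    rw [hu.isWeakSolution.inner_eq _ _ (G.toLp_mem_formSpace.2 ⟨_, by simp, hz⟩), inner_smul_right]
  -- The combination vanishes at the vertices and is orthogonal to the Dirichlet eigenfunctions
  -- below μ. Taking k = p, where `lamD p = μ`, leaves nonnegativity of the shifted form.
  have h1 := hD.sub_mul_norm_sq_le (μ := μ) (fun _ _ => rfl) hgx hw2 p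
  rw [hp, sub_self, zero_mul, norm_sq_sub_of_inner_eq w.2 (hweak (h.hasGradient_sum w.1))
    (hweak hgu), h.norm_sq_sub_eq] at h1
  have hneg : ∀ i : Fin n, lam i - μ < 0 := fun i => by
    have := hmono (Nat.lt_succ_iff.1 i.2)
    linarith
  have hnonpos : ∀ i ∈ (Finset.univ : Finset (Fin n)),
      (lam i - μ) * ‖w.1 i‖ ^ 2 ≤ 0 := fun i _ =>
    mul_nonpos_of_nonpos_of_nonneg (hneg i).le (sq_nonneg _)
  have h2 := (Finset.sum_eq_zero_iff_of_nonpos hnonpos).1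
    (le_antisymm (Finset.sum_nonpos hnonpos) h1)
  have hw10 : w.1 = 0 := funext fun i => by
    have h3 := (mul_eq_zero.1 (h2 i (Finset.mem_univ i))).resolve_left (hneg i).ne
    simpa using h3
  apply hw0
  refine Prod.ext hw10 ?_
  -- Only a multiple of u is left, and u does not vanish at any vertex.
  have h4 := congrFun hw1 (G.o (Classical.arbitrary E))
  simpa [hw10, ha] using h4

end MetricGraph

end

/-! ### The main theorem -/

/-- The eigenvalues are listed from the index `0` on: `lam j` is the `(j+1)`-st eigenvalue of the
standard Laplacian, and `lamD j` the `(j+1)`-st eigenvalue of the Dirichlet Laplacian. -/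
theorem theorem4p1 {V E : Type*} [Fintype V] [Fintype E] [Nonempty E] (G : MetricGraph V E)
    (hG : G.IsTree) :
    (∃ lam : ℕ → ℝ, IsEigenvalueEnumeration G.standardLaplacian lam) ∧
    (∃ lamD : ℕ → ℝ, IsEigenvalueEnumeration G.dirichletLaplacian lamD) ∧
    ∀ lam lamD : ℕ → ℝ, IsEigenvalueEnumeration G.standardLaplacian lam →
      IsEigenvalueEnumeration G.dirichletLaplacian lamD →
      (∀ j, lam (j + 1) ≤ lamD j) ∧
      ((∀ j, lam (j + 1) < lamD j) ↔
        ∃ e e' : E, LinearIndependent ℚ ![G.len e, G.len e']) := by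
  obtain ⟨R, hR⟩ := G.exists_isCompactResolvent_standard
  obtain ⟨RD, hRD⟩ := G.exists_isCompactResolvent_dirichlet
  refine ⟨hR.exists_enumeration G.not_finiteDimensional_L2,
    hRD.exists_enumeration G.not_finiteDimensional_L2, fun lam lamD hlam hlamD => ?_⟩
  obtain ⟨b, hb⟩ := hR.exists_hilbertBasis hlam
  obtain ⟨bD, hbD⟩ := hRD.exists_hilbertBasis hlamD
  obtain ⟨b', c, h⟩ := MetricGraph.exists_isEigenbasis
    (fun _ _ => MetricGraph.mem_standardLaplacian_graph) hb
  obtain ⟨bD', cD, hD⟩ := MetricGraph.exists_isEigenbasis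
    (fun _ _ => MetricGraph.mem_dirichletLaplacian_graph) hbD
  have key : ∀ j, lamD j ≤ lam (j + 1) → ∃ ω : ℝ, ω ≠ 0 ∧ ω ^ 2 = lamD j ∧
      ∃ (u : G.L2) (a : V → ℂ), (∀ v, starRingEnd ℂ (a v) * a v = 1) ∧
      G.HasEdgeData u (((ω ^ 2 : ℝ) : ℂ) • u) a (fun e => Complex.I * ω * a (G.o e))
        (fun e => Complex.I * ω * a (G.t e)) ∧
      ∃ (f f' : G.L2) (r : ℂ), G.HasGradient 0 f f' ∧ f + r • u ≠ 0 ∧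
      ∀ k, inner ℂ (b k) (f + r • u) = 0 ∨ lam k = lamD j ∧ ¬ lamD j < lam (j + 1) := by
    intro j hj
    obtain ⟨ω, hω⟩ : ∃ ω : ℝ, ω ^ 2 = lamD j := ⟨√(lamD j), Real.sq_sqrt (hD.pos j).le⟩
    have hω0 : ω ≠ 0 := by
      rintro rfl
      have := hD.pos j
      rw [← hω] at this
      simp at this
    obtain ⟨u, a, ha, hu⟩ := hG.exists_wave ω
    refine ⟨ω, hω0, hω, u, a, ha, hu, ?_⟩
    refine MetricGraph.exists_standard_eigenfunction_of_le h hD hlam.1 hlamD.1 hj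
      (fun v h0 => by simpa [h0] using ha v) (hω ▸ hu) ?_
    -- Since |a| = 1 at the vertices, each edge contributes iω - iω = 0.
    rw [← G.sum_mul_sub_mul (fun v => starRingEnd ℂ (a v))]
    refine Finset.sum_eq_zero fun e _ => ?_
    linear_combination Complex.I * ω * (ha (G.t e)) - Complex.I * ω * (ha (G.o e))
  have hle : ∀ j, lam (j + 1) ≤ lamD j := fun j => by
    by_contra! hlt
    obtain ⟨ω, -, -, u, a, -, -, f, f', r, -, hx0, hx⟩ := key j hlt.le
    apply hx0
    apply b.repr.injective
    ext k
    rw [b.repr_apply_apply, map_zero]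
    exact (hx k).resolve_right fun h0 => h0.2 hlt
  refine ⟨hle, ⟨fun hlt => ?_, ?_⟩⟩
  · by_contra! hdep
    obtain ⟨ω, hω0, hω⟩ := G.exists_resonance hdep
    have := hRD.finiteDimensional_kerSub ((ω ^ 2 : ℝ) : ℂ)
    have h1 := MetricGraph.card_le_finrank_kerSub_dirichlet hω0 hω
    have hset : {j | lamD j = ω ^ 2} = {j | (lamD j : ℂ) = ((ω ^ 2 : ℝ) : ℂ)} := by
      ext j
      exact Complex.ofReal_inj.symm
    have hcard : (Fintype.card E : ℕ∞) ≤ {j | lamD j = ω ^ 2}.encard := by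
      rw [hset, (hlamD.2 _).2]
      exact_mod_cast h1
    obtain ⟨p, hp, hp', hp''⟩ := MetricGraph.exists_consecutive hlamD.1 Fintype.card_pos hcard
    have h2 := MetricGraph.not_lt_of_resonance hG h hD hlam.1 hω hp hp'
    -- The last of |E| consecutive Dirichlet indices starting from p: there `lamD` is at most ω²,
    -- while the next standard index p + |E| has value at least ω².
    have h3 := hlt (p + (Fintype.card E - 1))
    have h4 : p + (Fintype.card E - 1) + 1 = p + Fintype.card E := by
      have : 0 < Fintype.card E := Fintype.card_pos
      omega
    rw [h4] at h3
    linarith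
  · rintro ⟨e, e', hee⟩ j
    refine lt_of_le_of_ne (hle j) fun heq => ?_
    obtain ⟨ω, hω0, hω, u, a, ha, hu, f, f', r, hf, hx0, hx⟩ := key j heq.ge
    have hgraph := hR.mem_graph_of_coeff hb (μ := ω ^ 2) fun k =>
      (hx k).imp_right fun h0 => h0.1.trans hω.symm
    obtain ⟨d, γ, δ, hsol⟩ := MetricGraph.mem_standardLaplacian_graph.1 hgraph
    -- Two rationally independent lengths cannot both be resonant, so one of the two edges serves as
    -- the nonresonant edge.
    by_cases hsin : Real.sin (ω * G.len e) = 0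
    · by_cases hsin' : Real.sin (ω * G.len e') = 0
      · exact MetricGraph.not_linearIndependent_of_sin_eq_zero hω0 (G.len_pos e) hsin hsin' hee
      · exact hx0 (hG.eq_zero_of_isStrongSolution ha hu hf hsol hsin')
    · exact hx0 (hG.eq_zero_of_isStrongSolution ha hu hf hsol hsin)
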